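/- **Setting.** Let $M=\mathbb R\times N$ be a space-time split by a global time function, where $N$ is a second countable Hausdorff smooth manifold, with a locally finite measure of full support (e.g. given by a volume form). A closed set $K\subset M$ is *spatially compact* if $K\cap([t',t]\times N)$ is compact for all $t',t$. For a smooth vector bundle $E\to M$, $\Gamma(E)$ denotes the smooth sections, $\Gamma_0(E)$ those with compact support, and $\Gamma_+(E)$ (advanced) resp. $\Gamma_-(E)$ (retarded) those with spatially compact support contained in $[t,\infty)\times N$ resp. $(-\infty,t]\times N$ for some $t$. The contraction of dual sections includes integration over $M$. Let $B,E,F\to M$ be smooth vector bundles, and let $\mathcal M=\Gamma(B)$ be the space of fields $\varphi$. A map defined on $\mathcal M$ is called smooth if it takes finite-dimensional smooth families of fields to smooth families, and local if it is smooth and its value at $x\in M$ depends only on the jets of its arguments at $x$ of some fixed finite order. Let $T:\mathcal M\to\Gamma(E)$ be local, $\Sigma=\{\varphi: T[\varphi]=0\}$ the shell, $\approx$ equality on $\Sigma$, and $J_{ai}=T_{a,i}$ the linearization of $T$. Let $R[\varphi]:\Gamma(F)\to\Gamma(B)$ and $V[\varphi]:\Gamma(E^*)\to\Gamma(B)$ be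 linear differential operators depending locally on $\varphi$, regarded as collections $R_\alpha$, $V_a$ of vector fields on $\mathcal M$. Assume: 1. (regularity) $\Sigma$ is a smooth submanifold with tangent spaces $\operatorname{Ker}J$: for $\varphi\in\Sigma$, each $X\in\Gamma(B)$ with spatially compact support and $J[\varphi]X=0$ is the velocity at $\varphi$ of a smooth curve in $\Sigma$; 2. (gauge symmetry) $R_\alpha T_a=C_{\alpha a}^bT_b$ with local $C_{\alpha a}^b$; 3. (completeness) for each $\varphi\in\Sigma$ and each sign, the sequences $\Gamma_\pm(F)\xrightarrow{R}\Gamma_\pm(B)\xrightarrow{J}\Gamma_\pm(E)$ and $\Gamma_\pm(E^*)\xrightarrow{J^*}\Gamma_\pm(B^*)\xrightarrow{R^*}\Gamma_\pm(F^*)$ are exact at the middle term; 4. ($V$ is a Lagrange anchor with local structure functions) there are local $C_{ab}^d$, $D_{ab}^\alpha$, $W_a^{ij}$ with $V_aT_b-V_bT_a=C_{ab}^dT_d$ on all of $\mathcal M$, $W_a^{ij}\approx W_a^{ji}$, and $$[V_a,V_b]^i\approx C_{ab}^dV_d^i+D_{ab}^\alpha R_\alpha^i+J_{aj}W_b^{ji}-J_{bj}W_a^{ji}.$$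 Let $\Phi_0$ be the algebra of smooth functionals $A:\mathcal M\to\mathbb R$ having a smooth functional derivative $\delta A=A_{,i}\,\delta\varphi^i$ with values in $\Gamma_0(B^*)$ (with supports that are locally uniformly compact along smooth families). A *physical observable* is an $A\in\Phi_0$ with $R_\alpha A\approx0$. An *advanced/retarded fluctuation* caused by $A\in\Phi_0$ is a smooth vector field $V_A^\pm:\mathcal M\to\Gamma_\pm(B)$ (with supports locally uniformly in such a class) that acts on $\Phi_0$ by differentiation and satisfies $V_A^\pm T_a\approx V_aA$. The *advanced/retarded brackets* are $\{A,B\}^\pm=V_A^\pm B-V_B^\pm A$. **Proposition 4.3 (Jacobi identity).** For all physical observables $A,B,C$ and either sign, $$\{\{A,B\}^\pm,C\}^\pm+\{\{B,C\}^\pm,A\}^\pm+\{\{C,A\}^\pm,B\}^\pm\approx0,$$ whatever fluctuations are chosen to form each of the six brackets. -/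

import Mathlib

open Bundle Set Filter Topology MeasureTheory
open scoped Manifold ContDiff

noncomputable section

namespace CovariantBracket

universe u v

/-! ### Space-time, vector bundles over it, and their smooth sections -/

/-- Space-time, split by a global time function: `M = ℝ × N`, with `N` the Cauchy surface. -/
abbrev Spacetime (N : Type u) : Type u := ℝ × N

/-- The linear model of the space-time. -/
abbrev Model (d : ℕ) : Type := ℝ × EuclideanSpace ℝ (Fin d)

/-- The space of the charts of the space-time. -/
abbrev ChartModel (d : ℕ) : Type := ModelProd ℝ (EuclideanSpace ℝ (Fin d))

/-- The model with corners of the space-time (no boundary). -/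
abbrev stModel (d : ℕ) : ModelWithCorners ℝ (Model d) (ChartModel d) := 𝓘(ℝ, ℝ).prod (𝓡 d)

/-- A smooth real vector bundle of finite rank over the space-time `ℝ × N`. The norms on the fibres
only serve to present their topology. -/
structure VBundle (d : ℕ) (N : Type u) [TopologicalSpace N]
    [ChartedSpace (EuclideanSpace ℝ (Fin d)) N] where
  /-- the model fibre -/
  F : Type v
  /-- the fibres -/
  fib : Spacetime N → Type v
  [normF : NormedAddCommGroup F]
  [spaceF : NormedSpace ℝ F]
  [finF : FiniteDimensional ℝ F]
  [normFib : ∀ x, NormedAddCommGroup (fib x)]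
  [spaceFib : ∀ x, NormedSpace ℝ (fib x)]
  [top : TopologicalSpace (TotalSpace F fib)]
  [fiberBundle : FiberBundle F fib]
  [vectorBundle : VectorBundle ℝ F fib]
  [smooth : ContMDiffVectorBundle ∞ F fib (stModel d)]

attribute [instance] VBundle.normF VBundle.spaceF VBundle.finF VBundle.normFib VBundle.spaceFib
  VBundle.top VBundle.fiberBundle VBundle.vectorBundle VBundle.smooth

variable {d : ℕ} {N : Type u} [TopologicalSpace N] [ChartedSpace (EuclideanSpace ℝ (Fin d)) N]

/-- The dual bundle. -/
def VBundle.dual (E : VBundle.{u, v} d N) : VBundle.{u, v} d N where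
  F := E.F →L[ℝ] ℝ
  fib := fun x => E.fib x →L[ℝ] Bundle.Trivial (Spacetime N) ℝ x
  normFib := fun x => inferInstanceAs (NormedAddCommGroup (E.fib x →L[ℝ] ℝ))
  spaceFib := fun x => inferInstanceAs (NormedSpace ℝ (E.fib x →L[ℝ] ℝ))
  top := inferInstance
  fiberBundle := inferInstance
  vectorBundle := inferInstance
  smooth := inferInstance

/-- `Γ(E)`: the smooth sections of `E`. -/
abbrev Sec (E : VBundle.{u, v} d N) : Type (max u v) :=
  ContMDiffSection (stModel d) E.F ∞ E.fib

/-- The fibrewise pairing of a covector with a vector. -/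
def ev {E : VBundle.{u, v} d N} {x : Spacetime N} (a : E.dual.fib x) (v : E.fib x) : ℝ :=
  (show E.fib x →L[ℝ] ℝ from a) v

/-- The contraction `ζ_a ξ^a` of a section `ζ` of the dual bundle with a (not necessarily smooth)
section `ξ`, which includes the integration over the space-time. -/
def pair {E : VBundle.{u, v} d N} [MeasurableSpace N] (μ : Measure (Spacetime N))
    (ζ : Sec E.dual) (ξ : ∀ x, E.fib x) : ℝ :=
  ∫ x, ev (ζ x) (ξ x) ∂μ

/-! ### Supports -/

/-- The support of a section. -/
def supp {E : VBundle.{u, v} d N} (ξ : Sec E) : Set (Spacetime N) :=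
  closure {x | ξ x ≠ 0}

variable (N) in
/-- Compact subsets of the space-time. -/
def compactSets : Set (Set (Spacetime N)) := {K | IsCompact K}

variable (N) in
/-- Spatially compact closed sets: the part between any two instants of time is compact. -/
def spatiallyCompactSets : Set (Set (Spacetime N)) :=
  {K | IsClosed K ∧ ∀ t' t : ℝ, IsCompact (K ∩ {x | t' ≤ x.1 ∧ x.1 ≤ t})}

/-- The choice between advanced (`+`) and retarded (`-`). -/
inductive Dir
  | adv
  | ret

/-- The supports admitted in `Γ_±`: spatially compact closed sets contained in
`M_t^+ = [t, ∞) × N` (advanced) or in `M_t^- = (-∞, t] × N` (retarded) for some `t`. -/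
def Dir.sets (N : Type u) [TopologicalSpace N] : Dir → Set (Set (Spacetime N))
  | .adv => {K | K ∈ spatiallyCompactSets N ∧ ∃ t : ℝ, K ⊆ {x | t ≤ x.1}}
  | .ret => {K | K ∈ spatiallyCompactSets N ∧ ∃ t : ℝ, K ⊆ {x | x.1 ≤ t}}

/-! ### Smooth families, local sections and local operators -/

/-- `φ` is a smooth family of sections: `φ p x` is jointly smooth in the parameter `p`, which runs
over a normed space, and the point `x`. -/
def SmoothFamily {E : VBundle.{u, v} d N} {P : Type} [NormedAddCommGroup P] [NormedSpace ℝ P]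
    (φ : P → Sec E) : Prop :=
  ContMDiff (𝓘(ℝ, P).prod (stModel d)) ((stModel d).prod 𝓘(ℝ, E.F)) ∞
    (fun q : P × Spacetime N => (⟨q.2, φ q.1 q.2⟩ : TotalSpace E.F E.fib))

/-- The velocity at `s = 0` of a curve of sections. -/
def HasVelocity {E : VBundle.{u, v} d N} (φ : ℝ → Sec E) (X : Sec E) : Prop :=
  ∀ x, HasDerivAt (fun s => φ s x) (X x) 0

/-- The map `ξ` between spaces of sections is smooth: it takes finite-dimensional smooth families
to smooth families. -/
def SmoothMap {B E : VBundle.{u, v} d N} (ξ : Sec B → Sec E) : Prop :=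
  ∀ (P : Type) [NormedAddCommGroup P] [NormedSpace ℝ P] [FiniteDimensional ℝ P] (φ : P → Sec B),
    SmoothFamily φ → SmoothFamily (fun p => ξ (φ p))

/-- The map `ξ` takes values in sections with supports in the class `S`, locally uniformly along
finite-dimensional smooth families (so that derivatives of `ξ` have such supports too). -/
def SupportedIn {B E : VBundle.{u, v} d N} (S : Set (Set (Spacetime N)))
    (ξ : Sec B → Sec E) : Prop :=
  ∀ (P : Type) [NormedAddCommGroup P] [NormedSpace ℝ P] [FiniteDimensional ℝ P] (φ : P → Sec B),
    SmoothFamily φ → ∀ p, ∃ K ∈ S, ∀ᶠ q in 𝓝 p, supp (ξ (φ q)) ⊆ K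

/-- The section `s` read in the preferred chart and the preferred trivialization at `x`. -/
def localRep {E : VBundle.{u, v} d N} (s : Sec E) (x : Spacetime N) : Model d → E.F :=
  fun y => (trivializationAt E.F E.fib x
    ⟨(extChartAt (stModel d) x).symm y, s ((extChartAt (stModel d) x).symm y)⟩).2

/-- Two sections have the same `n`-jet at `x`: their partial derivatives at `x` up to the order `n`
coincide. -/
def SameJet {E : VBundle.{u, v} d N} (n : ℕ) (s t : Sec E) (x : Spacetime N) : Prop :=
  ∀ k ≤ n, iteratedFDeriv ℝ k (localRep s x) (extChartAt (stModel d) x x) =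
    iteratedFDeriv ℝ k (localRep t x) (extChartAt (stModel d) x x)

/-- `T ∈ Γ_loc(𝓔)`: `T[φ](x)` is a smooth function of `x` and of the derivatives of `φ` at `x` up
to some finite order. -/
def IsLocalSection {B E : VBundle.{u, v} d N} (T : Sec B → Sec E) : Prop :=
  (∃ n : ℕ, ∀ (φ ψ : Sec B) (x : Spacetime N), SameJet n φ ψ x → T φ x = T ψ x) ∧ SmoothMap T

/-- The linear operators `P[φ] : Γ(E) → Γ(E')` are differential operators with local coefficients:
`P[φ]a` at `x` is a smooth function of `x` and the finite jets of `φ` and `a` at `x`. -/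
def IsLocalOp {B E E' : VBundle.{u, v} d N} (P : Sec B → Sec E →ₗ[ℝ] Sec E') : Prop :=
  (∃ n : ℕ, ∀ (φ ψ : Sec B) (a b : Sec E) (x : Spacetime N),
    SameJet n φ ψ x → SameJet n a b x → P φ a x = P ψ b x) ∧
  ∀ (Q : Type) [NormedAddCommGroup Q] [NormedSpace ℝ Q] [FiniteDimensional ℝ Q]
    (φ : Q → Sec B) (a : Q → Sec E),
    SmoothFamily φ → SmoothFamily a → SmoothFamily (fun q => P (φ q) (a q))

/-- The same for bilinear operators `P[φ] : Γ(E) × Γ(E') → Γ(E'')`. -/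
def IsLocalBiop {B E E' E'' : VBundle.{u, v} d N}
    (P : Sec B → Sec E →ₗ[ℝ] Sec E' →ₗ[ℝ] Sec E'') : Prop :=
  (∃ n : ℕ, ∀ (φ ψ : Sec B) (a b : Sec E) (a' b' : Sec E') (x : Spacetime N),
    SameJet n φ ψ x → SameJet n a b x → SameJet n a' b' x → P φ a a' x = P ψ b b' x) ∧
  ∀ (Q : Type) [NormedAddCommGroup Q] [NormedSpace ℝ Q] [FiniteDimensional ℝ Q]
    (φ : Q → Sec B) (a : Q → Sec E) (a' : Q → Sec E'),
    SmoothFamily φ → SmoothFamily a → SmoothFamily a' →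
      SmoothFamily (fun q => P (φ q) (a q) (a' q))

/-! ### Functionals and vector fields on the space of fields `𝓜 = Γ(B)` -/

/-- The derivative of the functional `A` at `φ` in the direction `X`. -/
def dirDeriv {B : VBundle.{u, v} d N} (A : Sec B → ℝ) (φ X : Sec B) : ℝ :=
  deriv (fun s : ℝ => A (φ + s • X)) 0

/-- The algebra `Φ₀` of smooth compactly supported functionals: `A` is smooth along
finite-dimensional smooth families of fields, and there is a functional derivative `δA`, a smooth
section of the cotangent bundle of `𝓜` with compact support, such that `δA_i X^i` is the derivative
of `A` along any smooth curve of fields with velocity `X`. -/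
def IsFunctional {B : VBundle.{u, v} d N} [MeasurableSpace N] (μ : Measure (Spacetime N))
    (A : Sec B → ℝ) : Prop :=
  (∀ (P : Type) [NormedAddCommGroup P] [NormedSpace ℝ P] [FiniteDimensional ℝ P] (φ : P → Sec B),
    SmoothFamily φ → ContDiff ℝ ∞ (fun p => A (φ p))) ∧
  ∃ δA : Sec B → Sec B.dual, SmoothMap δA ∧ SupportedIn (compactSets N) δA ∧
    ∀ (φ : ℝ → Sec B) (X : Sec B), SmoothFamily φ → HasVelocity φ X →
      HasDerivAt (fun s => A (φ s)) (pair μ (δA (φ 0)) X) 0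

/-- `X ∈ Γ_±(T𝓜)`: a smooth vector field on `𝓜` with advanced or retarded support, which acts on
the algebra `Φ₀` by differentiation. -/
def IsVectorField {B : VBundle.{u, v} d N} [MeasurableSpace N] (μ : Measure (Spacetime N))
    (σ : Dir) (X : Sec B → Sec B) : Prop :=
  SmoothMap X ∧ SupportedIn (σ.sets N) X ∧
    ∀ A : Sec B → ℝ, IsFunctional μ A → IsFunctional μ (fun φ => dirDeriv A φ (X φ))

/-! ### Field theories with a gauge symmetry and an anchor -/

/-- The data of the theory: the bundle of fields `B`, the dynamics bundle `E`, the gauge algebra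
bundle `G`, the field equations `T[φ] = 0`, the operators `R[φ]` with the gauge symmetry generators
as kernel, and the operators `V[φ]` with the Lagrange anchor as kernel, all of them local. -/
structure FieldTheory (d : ℕ) (N : Type u) [TopologicalSpace N]
    [ChartedSpace (EuclideanSpace ℝ (Fin d)) N] where
  B : VBundle.{u, v} d N
  E : VBundle.{u, v} d N
  G : VBundle.{u, v} d N
  T : Sec B → Sec E
  R : Sec B → Sec G →ₗ[ℝ] Sec B
  V : Sec B → Sec E.dual →ₗ[ℝ] Sec B
  T_local : IsLocalSection T
  R_local : IsLocalOp R
  V_local : IsLocalOp V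

namespace FieldTheory

variable (𝒯 : FieldTheory.{u, v} d N)

/-- The dynamical shell `Σ`. -/
def shell : Set (Sec 𝒯.B) := {φ | 𝒯.T φ = 0}

/-- The Jacobi operator, `(J[φ]X)_a = T_{a,i} X^i`: the linearization of the field equations. -/
def J (φ X : Sec 𝒯.B) : ∀ x, 𝒯.E.fib x :=
  fun x => deriv (fun s : ℝ => 𝒯.T (φ + s • X) x) 0

/-- The commutator at `φ` of the vector fields `V_a` and `V_b` contracted with constant `a`, `b`:
the derivative of `V[φ]b` along `V[φ]a` minus the derivative of `V[φ]a` along `V[φ]b`. -/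
def anchorCommutator (φ : Sec 𝒯.B) (a b : Sec 𝒯.E.dual) : ∀ x, 𝒯.B.fib x :=
  fun x => deriv (fun s : ℝ => 𝒯.V (φ + s • 𝒯.V φ a) b x) 0
    - deriv (fun s : ℝ => 𝒯.V (φ + s • 𝒯.V φ b) a x) 0

/-- Regularity of the field equations: the shell is a smooth submanifold of `𝓜` whose tangent space
is the kernel of the Jacobi operator, i.e. each spatially compact solution of the linearized
equations is the velocity of a smooth curve in the shell. -/
def IsRegular : Prop :=
  ∀ φ ∈ 𝒯.shell, ∀ X : Sec 𝒯.B, supp X ∈ spatiallyCompactSets N → (∀ x, 𝒯.J φ X x = 0) →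
    ∃ γ : ℝ → Sec 𝒯.B, SmoothFamily γ ∧ (∀ s, γ s ∈ 𝒯.shell) ∧ γ 0 = φ ∧ HasVelocity γ X

/-- `R_α T_a = C_{αa}^b T_b` with local structure functions `C`. -/
def IsGaugeSymmetry : Prop :=
  ∃ C : Sec 𝒯.B → Sec 𝒯.G →ₗ[ℝ] Sec 𝒯.E →ₗ[ℝ] Sec 𝒯.E, IsLocalBiop C ∧
    ∀ (φ : Sec 𝒯.B) (ε : Sec 𝒯.G) (x), 𝒯.J φ (𝒯.R φ ε) x = C φ ε (𝒯.T φ) x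

/-- On-shell exactness of `Γ_±(G) → Γ_±(T𝓜) → Γ_±(E)`, with the maps `R` and `J`, at the middle
term (that `J ∘ R` vanishes on shell is part of `IsGaugeSymmetry`). -/
def IsExact (σ : Dir) : Prop :=
  ∀ φ ∈ 𝒯.shell, ∀ X : Sec 𝒯.B, supp X ∈ σ.sets N → (∀ x, 𝒯.J φ X x = 0) →
    ∃ ε : Sec 𝒯.G, supp ε ∈ σ.sets N ∧ X = 𝒯.R φ ε

variable [MeasurableSpace N] (μ : Measure (Spacetime N))

/-- On-shell exactness of `Γ_±(E^*) → Γ_±(T^*𝓜) → Γ_±(G^*)`, with the maps `J^*` and `R^*`, at the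
middle term. The equations `R^* η = 0` and `η = J^* ζ` for the formal adjoint operators are
expressed through arbitrary test sections with compact supports. -/
def IsDualExact (σ : Dir) : Prop :=
  ∀ φ ∈ 𝒯.shell, ∀ η : Sec 𝒯.B.dual, supp η ∈ σ.sets N →
    (∀ ε : Sec 𝒯.G, IsCompact (supp ε) → pair μ η (𝒯.R φ ε) = 0) →
    ∃ ζ : Sec 𝒯.E.dual, supp ζ ∈ σ.sets N ∧
      ∀ h : Sec 𝒯.B, IsCompact (supp h) → pair μ η h = pair μ ζ (𝒯.J φ h)

/-- `V` is a Lagrange anchor with local structure functions `C`, `D`, `W`: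
* `V_a T_b - V_b T_a = C_{ab}^d T_d` identically;
* `W_a^{ij} = W_a^{ji}` on shell;
* `[V_a, V_b]^i = C_{ab}^d V_d^i + D_{ab}^α R_α^i + J_{aj} W_b^{ji} - J_{bj} W_a^{ji}` on shell.

All free indices are contracted with test sections. -/
def IsLagrangeStructure : Prop :=
  ∃ (C : Sec 𝒯.B → Sec 𝒯.E.dual →ₗ[ℝ] Sec 𝒯.E.dual →ₗ[ℝ] Sec 𝒯.E.dual)
    (D : Sec 𝒯.B → Sec 𝒯.E.dual →ₗ[ℝ] Sec 𝒯.E.dual →ₗ[ℝ] Sec 𝒯.G)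
    (W : Sec 𝒯.B → Sec 𝒯.E.dual →ₗ[ℝ] Sec 𝒯.B.dual →ₗ[ℝ] Sec 𝒯.B),
    IsLocalBiop C ∧ IsLocalBiop D ∧ IsLocalBiop W ∧
    (∀ (φ : Sec 𝒯.B) (a b : Sec 𝒯.E.dual), IsCompact (supp a) → IsCompact (supp b) →
      pair μ b (𝒯.J φ (𝒯.V φ a)) - pair μ a (𝒯.J φ (𝒯.V φ b)) = pair μ (C φ a b) (𝒯.T φ)) ∧
    (∀ φ ∈ 𝒯.shell, ∀ (a : Sec 𝒯.E.dual) (α β : Sec 𝒯.B.dual),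
      IsCompact (supp α) → IsCompact (supp β) →
      pair μ β (W φ a α) = pair μ α (W φ a β)) ∧
    (∀ φ ∈ 𝒯.shell, ∀ (a b : Sec 𝒯.E.dual) (γ : Sec 𝒯.B.dual), IsCompact (supp γ) →
      pair μ γ (𝒯.anchorCommutator φ a b) =
        pair μ γ (𝒯.V φ (C φ a b)) + pair μ γ (𝒯.R φ (D φ a b))
          + pair μ a (𝒯.J φ (W φ b γ)) - pair μ b (𝒯.J φ (W φ a γ)))

/-- Physical observables: functionals `A ∈ Φ₀` with `A_{,i} R^i_α = 0` on shell. -/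
def IsObservable (A : Sec 𝒯.B → ℝ) : Prop :=
  IsFunctional μ A ∧
    ∀ φ ∈ 𝒯.shell, ∀ ε : Sec 𝒯.G, IsCompact (supp ε) → dirDeriv A φ (𝒯.R φ ε) = 0

/-- `X` is an advanced or retarded fluctuation `V_A^±` caused by `A`: a vector field from
`Γ_±(T𝓜)` such that `X T_a = V_a A` on shell (the index `a` is contracted with a test section). -/
def IsFluctuation (σ : Dir) (A : Sec 𝒯.B → ℝ) (X : Sec 𝒯.B → Sec 𝒯.B) : Prop :=
  IsVectorField μ σ X ∧
    ∀ φ ∈ 𝒯.shell, ∀ ζ : Sec 𝒯.E.dual, IsCompact (supp ζ) →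
      pair μ ζ (𝒯.J φ (X φ)) = dirDeriv A φ (𝒯.V φ ζ)

/-- `H` represents the bracket `{A, B}^± = V_A^± B - V_B^± A`, for some choice of the
fluctuations `V_A^±` and `V_B^±`. -/
def IsBracket (σ : Dir) (A B H : Sec 𝒯.B → ℝ) : Prop :=
  ∃ X Y : Sec 𝒯.B → Sec 𝒯.B, 𝒯.IsFluctuation μ σ A X ∧ 𝒯.IsFluctuation μ σ B Y ∧
    ∀ φ, H φ = dirDeriv B φ (X φ) - dirDeriv A φ (Y φ)

end FieldTheory

end CovariantBracket

end

/-!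
On shell, dual completeness turns the gauge invariance of an observable `A` into a Lagrange
multiplier: `δA = J^* ζ_A`. Hence `A - ζ_A^a T_a` is critical at the given field `φ`, and the anchor
produces a second solution `V ζ_A` of the equation `J X = V A` for fluctuations, so that
`V ζ_A - V_A^±` is tangent to the shell. Differentiating `{A, B}^±` along `V ζ_C - V_C^±` expresses
`{{A, B}^±, C}^±` by the second derivatives of `A - ζ_A^a T_a` and `B - ζ_B^a T_a` at `φ` and by
derivatives of `V_a` along the anchor. In the cyclic sum the former cancel by the symmetry of second
derivatives, the latter by the integrability of the anchor and the symmetry of `W`. Different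
fluctuations caused by `A` differ by a gauge transformation, which these second derivatives do not
see in directions tangent to the shell.

The support of `ζ_A` is noncompact, so `ζ_A^a T_a` need not be integrable; it is replaced by
`χ ζ_A^a T_a` for a cutoff function `χ` which is `1` on a sufficiently large compact set.
-/

noncomputable section

namespace CovariantBracket

universe u v

/-! ### Derivatives along the diagonal and smoothness of parametric integrals -/

section Calculus

theorem hasDerivAt_diag {F : Type*} [NormedAddCommGroup F] [NormedSpace ℝ F] {f : ℝ × ℝ → F}
    {a b : F} (hf : DifferentiableAt ℝ f 0) (ha : HasDerivAt (fun t => f (t, 0)) a 0)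
    (hb : HasDerivAt (fun t => f (0, t)) b 0) : HasDerivAt (fun t => f (t, t)) (a + b) 0 := by
  have along (v : ℝ × ℝ) : HasDerivAt (fun t : ℝ => f (t • v)) (fderiv ℝ f 0 v) 0 := by
    have h0 : HasFDerivAt f (fderiv ℝ f 0) ((0 : ℝ) • v) := by
      rw [zero_smul]
      exact hf.hasFDerivAt
    simpa [Function.comp_def] using
      h0.comp_hasDerivAt (0 : ℝ) ((hasDerivAt_id (0 : ℝ)).smul_const v)
  have ha' : fderiv ℝ f 0 (1, 0) = a := (by simpa using along (1, 0) : HasDerivAt _ _ _).unique ha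
  have hb' : fderiv ℝ f 0 (0, 1) = b := (by simpa using along (0, 1) : HasDerivAt _ _ _).unique hb
  have hab : fderiv ℝ f 0 (1, 1) = a + b := by
    rw [← ha', ← hb', ← map_add, Prod.mk_add_mk, add_zero, zero_add]
  simpa [hab] using along (1, 1)

variable {P W : Type*} [NormedAddCommGroup P] [NormedSpace ℝ P] [NormedAddCommGroup W]
  [NormedSpace ℝ W]

theorem continuous_slice_of_continuousOn {P X Y : Type*} [TopologicalSpace P] [TopologicalSpace X]
    [TopologicalSpace Y] {f : P → X → Y} {U : Set P} (hf : ContinuousOn f.uncurry (U ×ˢ univ))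
    {p : P} (hp : p ∈ U) : Continuous (f p) :=
  hf.comp_continuous (by fun_prop : Continuous fun x => (p, x)) fun x => ⟨hp, mem_univ x⟩

theorem hasFDerivAt_setIntegral_of_continuousOn {X : Type*} [TopologicalSpace X] [T2Space X]
    [MeasurableSpace X] [BorelSpace X] (μ : Measure X) [IsFiniteMeasureOnCompacts μ] {U : Set P}
    (hU : IsOpen U) {K : Set X} (hK : IsCompact K) {f : P → X → W} {f' : P → X → P →L[ℝ] W}
    (hf : ContinuousOn f.uncurry (U ×ˢ univ)) (hf' : ContinuousOn f'.uncurry (U ×ˢ univ))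
    (hd : ∀ p ∈ U, ∀ x, HasFDerivAt (f · x) (f' p x) p) {p : P} (hp : p ∈ U) :
    HasFDerivAt (fun p => ∫ x in K, f p x ∂μ) (∫ x in K, f' p x ∂μ) p := by
  obtain ⟨b, hb⟩ := (hK.image (continuous_slice_of_continuousOn hf' hp).norm).bddAbove
  have hbound : ∀ᶠ q in 𝓝 p, ∀ x ∈ K, ‖f' q x‖ < b + 1 := by
    refine hK.eventually_forall_of_forall_eventually fun x hx => ?_
    have hcont : ContinuousAt f'.uncurry (p, x) :=
      hf'.continuousAt ((hU.prod isOpen_univ).mem_nhds ⟨hp, mem_univ x⟩)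
    exact hcont.norm.eventually_lt continuousAt_const
      ((hb (mem_image_of_mem _ hx)).trans_lt (lt_add_one b))
  have : IsFiniteMeasure (μ.restrict K) := ⟨by simpa using hK.measure_lt_top⟩
  refine hasFDerivAt_integral_of_dominated_of_fderiv_le (bound := fun _ => b + 1)
    (hbound.and (hU.mem_nhds hp)) ?_ ?_ ?_ ?_ (integrable_const _) ?_
  · filter_upwards [hU.mem_nhds hp] with q hq
    exact (continuous_slice_of_continuousOn hf hq).continuousOn
      |>.aestronglyMeasurable_of_isCompact hK hK.measurableSet
  · exact (continuous_slice_of_continuousOn hf hp).continuousOn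
      |>.integrableOn_compact' hK hK.measurableSet
  · exact (continuous_slice_of_continuousOn hf' hp).continuousOn
      |>.aestronglyMeasurable_of_isCompact hK hK.measurableSet
  · filter_upwards [ae_restrict_mem hK.measurableSet] with x hx q hq
    exact (hq.1 x hx).le
  · exact .of_forall fun x q hq => hd q hq.2 x

variable {EM : Type*} [NormedAddCommGroup EM] [NormedSpace ℝ EM] {HM : Type*} [TopologicalSpace HM]
  {I : ModelWithCorners ℝ EM HM} {M : Type*} [TopologicalSpace M] [ChartedSpace HM M]

theorem contMDiffAt_fderiv_param [IsManifold I 1 M] {f : P → M → W} {q : P × M}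
    (hf : ContMDiffAt (𝓘(ℝ, P).prod I) 𝓘(ℝ, W) ∞ f.uncurry q) :
    ContMDiffAt (𝓘(ℝ, P).prod I) 𝓘(ℝ, P →L[ℝ] W) ∞
      (fun r : P × M => fderiv ℝ (f · r.2) r.1) q := by
  have hshift : ContMDiffAt ((𝓘(ℝ, P).prod I).prod 𝓘(ℝ, P)) (𝓘(ℝ, P).prod I) ∞
      (fun z : (P × M) × P => (z.2, z.1.2)) (q, q.1) :=
    contMDiffAt_snd.prodMk contMDiffAt_fst.snd
  have hmfderiv := ContMDiffAt.mfderiv (I := 𝓘(ℝ, P)) (I' := 𝓘(ℝ, W)) (J := 𝓘(ℝ, P).prod I)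
    (n := ∞) (m := ∞) (fun (r : P × M) (p : P) => f p r.2) Prod.fst
    (ContMDiffAt.comp (q, q.1) (g := f.uncurry) hf hshift) contMDiffAt_fst (by simp)
  have hcoord : inTangentCoordinates 𝓘(ℝ, P) 𝓘(ℝ, W) Prod.fst (fun r : P × M => f r.1 r.2)
      (fun r => mfderiv 𝓘(ℝ, P) 𝓘(ℝ, W) (f · r.2) r.1) q = fun r => fderiv ℝ (f · r.2) r.1 :=
    (inTangentCoordinates_model_space _ _ _ _).trans (funext fun _ => mfderiv_eq_fderiv)
  exact hcoord ▸ hmfderiv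

variable [IsManifold I 1 M] [T2Space M] [MeasurableSpace M] [BorelSpace M] (μ : Measure M)
  [IsFiniteMeasureOnCompacts μ] {K : Set M}

theorem hasFDerivAt_setIntegral_of_contMDiffOn {U : Set P} (hU : IsOpen U) (hK : IsCompact K)
    {f : P → M → W} (hf : ContMDiffOn (𝓘(ℝ, P).prod I) 𝓘(ℝ, W) ∞ f.uncurry (U ×ˢ univ))
    {p : P} (hp : p ∈ U) :
    HasFDerivAt (fun p => ∫ x in K, f p x ∂μ) (∫ x in K, fderiv ℝ (f · x) p ∂μ) p := by
  have hat (q) (hq : q ∈ U) (x) : ContMDiffAt (𝓘(ℝ, P).prod I) 𝓘(ℝ, W) ∞ f.uncurry (q, x) :=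
    hf.contMDiffAt ((hU.prod isOpen_univ).mem_nhds ⟨hq, mem_univ x⟩)
  refine hasFDerivAt_setIntegral_of_continuousOn μ hU hK hf.continuousOn
    (f' := fun p x => fderiv ℝ (f · x) p) (fun q hq => ?_) (fun q hq x => ?_) hp
  · exact (contMDiffAt_fderiv_param (hat q.1 hq.1 q.2)).continuousAt.continuousWithinAt
  · have hslice : ContMDiffAt 𝓘(ℝ, P) 𝓘(ℝ, W) ∞ (f · x) q :=
      ContMDiffAt.comp q (g := f.uncurry) (hat q hq x) (contMDiffAt_id.prodMk contMDiffAt_const)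
    exact (hslice.contDiffAt.differentiableAt (by simp)).hasFDerivAt

theorem contDiffOn_setIntegral_of_contMDiffOn {P : Type} [NormedAddCommGroup P] [NormedSpace ℝ P]
    {U : Set P} (hU : IsOpen U) (hK : IsCompact K) {W : Type v} [NormedAddCommGroup W]
    [NormedSpace ℝ W] {f : P → M → W}
    (hf : ContMDiffOn (𝓘(ℝ, P).prod I) 𝓘(ℝ, W) ∞ f.uncurry (U ×ˢ univ)) :
    ContDiffOn ℝ ∞ (fun p => ∫ x in K, f p x ∂μ) U := by
  -- The induction on the order of smoothness replaces `W` by `P →L[ℝ] W`.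
  suffices h : ∀ (n : ℕ) (W : Type v) [NormedAddCommGroup W] [NormedSpace ℝ W] (f : P → M → W),
      ContMDiffOn (𝓘(ℝ, P).prod I) 𝓘(ℝ, W) ∞ f.uncurry (U ×ˢ univ) →
      ContDiffOn ℝ n (fun p => ∫ x in K, f p x ∂μ) U from
    contDiffOn_infty.2 fun n => h n W f hf
  clear hf f
  intro n W _ _ f hf
  induction n generalizing W with
  | zero =>
    rw [Nat.cast_zero, contDiffOn_zero]
    exact fun p hp => (hasFDerivAt_setIntegral_of_contMDiffOn μ hU hK hf
      hp).continuousAt.continuousWithinAt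
  | succ n ih =>
    rw [Nat.cast_add, Nat.cast_one, contDiffOn_succ_iff_fderiv_of_isOpen hU]
    have hd (p) (hp : p ∈ U) := hasFDerivAt_setIntegral_of_contMDiffOn μ hU hK hf hp
    refine ⟨fun p hp => (hd p hp).differentiableAt.differentiableWithinAt, by simp, ?_⟩
    refine (ih (P →L[ℝ] W) (fun p x => fderiv ℝ (f · x) p) fun q hq => ?_).congr
      fun p hp => (hd p hp).fderiv
    exact (contMDiffAt_fderiv_param
      (hf.contMDiffAt ((hU.prod isOpen_univ).mem_nhds hq))).contMDiffWithinAt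

theorem contMDiffOn_setIntegral {EX : Type} [NormedAddCommGroup EX] [NormedSpace ℝ EX]
    {HX : Type*} [TopologicalSpace HX] {J : ModelWithCorners ℝ EX HX} [J.Boundaryless] {X : Type*}
    [TopologicalSpace X] [ChartedSpace HX X] [IsManifold J ∞ X] {U : Set X} (hU : IsOpen U)
    (hK : IsCompact K) {W : Type v} [NormedAddCommGroup W] [NormedSpace ℝ W] {f : X → M → W}
    (hf : ContMDiffOn (J.prod I) 𝓘(ℝ, W) ∞ f.uncurry (U ×ˢ univ)) :
    ContMDiffOn J 𝓘(ℝ, W) ∞ (fun x => ∫ y in K, f x y ∂μ) U := by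
  intro x₀ hx₀
  let c := extChartAt J x₀
  have hV : IsOpen (c.target ∩ c.symm ⁻¹' U) :=
    (continuousOn_extChartAt_symm x₀).isOpen_inter_preimage (isOpen_extChartAt_target x₀) hU
  have hchart : ContMDiffOn (𝓘(ℝ, EX).prod I) 𝓘(ℝ, W) ∞
      (fun q : EX × M => f (c.symm q.1) q.2) ((c.target ∩ c.symm ⁻¹' U) ×ˢ univ) :=
    hf.comp (((contMDiffOn_extChartAt_symm x₀).comp contMDiffOn_fst fun q hq => hq.1.1).prodMk
      contMDiffOn_snd) fun q hq => ⟨hq.1.2, mem_univ _⟩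
  have hsmooth : ContDiffOn ℝ ∞ (fun p => ∫ y in K, f (c.symm p) y ∂μ) (c.target ∩ c.symm ⁻¹' U) :=
    contDiffOn_setIntegral_of_contMDiffOn μ hV hK hchart
  have hx₀V : c x₀ ∈ c.target ∩ c.symm ⁻¹' U :=
    ⟨mem_extChartAt_target x₀, by simpa [c, mem_preimage, extChartAt_to_inv] using hx₀⟩
  refine (ContMDiffAt.comp x₀ (hsmooth.contDiffAt (hV.mem_nhds hx₀V)).contMDiffAt
    contMDiffAt_extChartAt).congr_of_eventuallyEq ?_ |>.contMDiffWithinAt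
  filter_upwards [extChartAt_source_mem_nhds (I := J) x₀] with x hx
  simp only [Function.comp_apply, c, (extChartAt J x₀).left_inv hx]

end Calculus

variable {d : ℕ} {N : Type u} [TopologicalSpace N] [ChartedSpace (EuclideanSpace ℝ (Fin d)) N]

/-! ### Smooth families of sections -/

section SmoothFields

variable {E : VBundle.{u, v} d N} {P : Type} [NormedAddCommGroup P] [NormedSpace ℝ P]

/-- Joint smoothness of a family of sections that are not bundled as smooth ones. -/
def SmoothField (s : P → ∀ x, E.fib x) : Prop :=
  ContMDiff (𝓘(ℝ, P).prod (stModel d)) ((stModel d).prod 𝓘(ℝ, E.F)) ∞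
    (fun q : P × Spacetime N => (⟨q.2, s q.1 q.2⟩ : TotalSpace E.F E.fib))

/-- The vector `w` at `x`, read in the preferred trivialization of `E` at `x₀`; meaningful only for
`x ∈ trivDom E x₀`. -/
def trivVal (E : VBundle.{u, v} d N) (x₀ x : Spacetime N) (w : E.fib x) : E.F :=
  (trivializationAt E.F E.fib x₀ ⟨x, w⟩).2

/-- The domain of the preferred trivialization of `E` at `x₀`. -/
def trivDom (E : VBundle.{u, v} d N) (x₀ : Spacetime N) : Set (Spacetime N) :=
  (trivializationAt E.F E.fib x₀).baseSet

theorem isOpen_trivDom (x₀ : Spacetime N) : IsOpen (trivDom E x₀) :=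
  (trivializationAt E.F E.fib x₀).open_baseSet

theorem mem_trivDom (x₀ : Spacetime N) : x₀ ∈ trivDom E x₀ :=
  FiberBundle.mem_baseSet_trivializationAt' x₀

/-- The preferred trivialization of `E` at `x₀`, on the fibre over a point of its domain. -/
def trivEquiv (E : VBundle.{u, v} d N) {x₀ x : Spacetime N} (hx : x ∈ trivDom E x₀) :
    E.fib x ≃L[ℝ] E.F :=
  (trivializationAt E.F E.fib x₀).continuousLinearEquivAt ℝ x hx

instance finiteDimensional_fib (x : Spacetime N) : FiniteDimensional ℝ (E.fib x) :=
  (trivEquiv E (mem_trivDom x)).toLinearEquiv.symm.finiteDimensional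

theorem trivVal_add {x₀ x : Spacetime N} (hx : x ∈ trivDom E x₀) (v w : E.fib x) :
    trivVal E x₀ x (v + w) = trivVal E x₀ x v + trivVal E x₀ x w :=
  map_add (trivEquiv E hx) v w

theorem trivVal_smul {x₀ x : Spacetime N} (hx : x ∈ trivDom E x₀) (c : ℝ) (w : E.fib x) :
    trivVal E x₀ x (c • w) = c • trivVal E x₀ x w :=
  map_smul (trivEquiv E hx) c w

theorem trivVal_fderiv {s : P → ∀ x, E.fib x} {x₀ x : Spacetime N} (hx : x ∈ trivDom E x₀)
    (p v : P) : trivVal E x₀ x (fderiv ℝ (fun p => s p x) p v) =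
      fderiv ℝ (fun p => trivVal E x₀ x (s p x)) p v :=
  congrArg (fun l : P →L[ℝ] E.F => l v)
    ((trivEquiv E hx).comp_fderiv (f := fun p => s p x) (x := p)).symm

theorem eventually_mem_trivDom {Q : Type*} [TopologicalSpace Q] (p : Q) (x : Spacetime N) :
    ∀ᶠ q : Q × Spacetime N in 𝓝 (p, x), q.2 ∈ trivDom E x :=
  continuousAt_snd.eventually ((isOpen_trivDom x).mem_nhds (mem_trivDom x))

theorem contMDiffAt_field_iff {Q : Type*} {EQ HQ : Type*} [NormedAddCommGroup EQ] [NormedSpace ℝ EQ]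
    [TopologicalSpace HQ] [TopologicalSpace Q] [ChartedSpace HQ Q] {IQ : ModelWithCorners ℝ EQ HQ}
    {b : Q → Spacetime N} {s : ∀ q, E.fib (b q)} {q : Q} {x₀ : Spacetime N}
    (hx : b q ∈ trivDom E x₀) :
    ContMDiffAt IQ ((stModel d).prod 𝓘(ℝ, E.F)) ∞
        (fun q => (⟨b q, s q⟩ : TotalSpace E.F E.fib)) q ↔
      ContMDiffAt IQ (stModel d) ∞ b q ∧
      ContMDiffAt IQ 𝓘(ℝ, E.F) ∞ (fun q => trivVal E x₀ (b q) (s q)) q :=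
  Bundle.Trivialization.contMDiffAt_iff (e := trivializationAt E.F E.fib x₀)
    (f := fun q => (⟨b q, s q⟩ : TotalSpace E.F E.fib))
    ((Trivialization.mem_source _).2 hx)

instance isManifold_spacetime_one [IsManifold (𝓡 d) ∞ N] :
    IsManifold (stModel d) 1 (Spacetime N) :=
  have : IsManifold (𝓡 d) 1 N := IsManifold.of_le (n := ∞) (by simp)
  inferInstance

namespace SmoothField

theorem contMDiffAt_trivVal {s : P → ∀ x, E.fib x} (hs : SmoothField s) {x₀ x : Spacetime N}
    (hx : x ∈ trivDom E x₀) (p : P) :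
    ContMDiffAt (𝓘(ℝ, P).prod (stModel d)) 𝓘(ℝ, E.F) ∞
      (fun q : P × Spacetime N => trivVal E x₀ q.2 (s q.1 q.2)) (p, x) :=
  ((contMDiffAt_field_iff (b := Prod.snd) (s := fun q : P × Spacetime N => s q.1 q.2)
    (q := (p, x)) hx).1 (hs (p, x))).2

theorem of_trivVal {s : P → ∀ x, E.fib x}
    (h : ∀ (p : P) (x : Spacetime N), ContMDiffAt (𝓘(ℝ, P).prod (stModel d)) 𝓘(ℝ, E.F) ∞
      (fun q : P × Spacetime N => trivVal E x q.2 (s q.1 q.2)) (p, x)) : SmoothField s :=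
  fun q => (contMDiffAt_field_iff (b := Prod.snd) (s := fun q : P × Spacetime N => s q.1 q.2)
    (q := q) (mem_trivDom q.2)).2 ⟨contMDiffAt_snd, h q.1 q.2⟩

theorem contMDiff_slice {s : P → ∀ x, E.fib x} (hs : SmoothField s) (p : P) :
    ContMDiff (stModel d) ((stModel d).prod 𝓘(ℝ, E.F)) ∞
      (fun x => (⟨x, s p x⟩ : TotalSpace E.F E.fib)) :=
  ContMDiff.comp (f := fun x : Spacetime N => (p, x)) hs (contMDiff_const.prodMk contMDiff_id)

/-- The members of a jointly smooth family, bundled as smooth sections. -/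
def sec {s : P → ∀ x, E.fib x} (hs : SmoothField s) (p : P) : Sec E :=
  ⟨s p, hs.contMDiff_slice p⟩

theorem smoothFamily_sec {s : P → ∀ x, E.fib x} (hs : SmoothField s) : SmoothFamily hs.sec :=
  hs

theorem add {s t : P → ∀ x, E.fib x} (hs : SmoothField s) (ht : SmoothField t) :
    SmoothField (fun p x => s p x + t p x) := by
  refine .of_trivVal fun p x => ?_
  refine ((hs.contMDiffAt_trivVal (mem_trivDom x) p).add
    (ht.contMDiffAt_trivVal (mem_trivDom x) p)).congr_of_eventuallyEq ?_
  filter_upwards [eventually_mem_trivDom (E := E) p x] with q hq using trivVal_add hq _ _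

theorem smul {s : P → ∀ x, E.fib x} (hs : SmoothField s) {f : P → Spacetime N → ℝ}
    (hf : ContMDiff (𝓘(ℝ, P).prod (stModel d)) 𝓘(ℝ, ℝ) ∞ f.uncurry) :
    SmoothField (fun p x => f p x • s p x) := by
  refine .of_trivVal fun p x => ?_
  refine ((hf (p, x)).smul (hs.contMDiffAt_trivVal (mem_trivDom x) p)).congr_of_eventuallyEq ?_
  filter_upwards [eventually_mem_trivDom (E := E) p x] with q hq using trivVal_smul hq _ _

theorem contDiff_apply {s : P → ∀ x, E.fib x} (hs : SmoothField s) (x : Spacetime N) :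
    ContDiff ℝ ∞ (fun p => s p x) := by
  have htriv : ContDiff ℝ ∞ (fun p => trivEquiv E (mem_trivDom x) (s p x)) := by
    rw [← contMDiff_iff_contDiff]
    exact fun p => ContMDiffAt.comp p (g := fun q : P × Spacetime N => trivVal E x q.2 (s q.1 q.2))
      (hs.contMDiffAt_trivVal (mem_trivDom x) p) (contMDiffAt_id.prodMk contMDiffAt_const)
  simpa only [Function.comp_def, ContinuousLinearEquiv.symm_apply_apply] using
    (trivEquiv E (mem_trivDom x)).symm.contDiff.comp htriv

variable [IsManifold (𝓡 d) ∞ N]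

theorem fderiv_apply {s : P → ∀ x, E.fib x} (hs : SmoothField s) (v : P) :
    SmoothField (fun p x => fderiv ℝ (fun p => s p x) p v) := by
  refine .of_trivVal fun p x => ?_
  have htriv := contMDiffAt_fderiv_param (P := P) (W := E.F)
    (f := fun p y => trivVal E x y (s p y)) (hs.contMDiffAt_trivVal (mem_trivDom x) p)
  refine ((ContinuousLinearMap.apply ℝ E.F v).contMDiff.contMDiffAt.comp (p, x)
    htriv).congr_of_eventuallyEq ?_
  filter_upwards [eventually_mem_trivDom (E := E) p x] with q hq using trivVal_fderiv hq _ _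

theorem unitIntervalIntegral {s : ℝ → ∀ x, E.fib x} (hs : SmoothField s) :
    SmoothField (fun t x => ∫ r in Icc (0 : ℝ) 1, s (r * t) x) := by
  refine .of_trivVal fun t x₀ => ?_
  have hU : IsOpen ((univ : Set ℝ) ×ˢ trivDom E x₀) := isOpen_univ.prod (isOpen_trivDom x₀)
  have hmem : (t, x₀) ∈ univ ×ˢ trivDom E x₀ := ⟨mem_univ t, mem_trivDom x₀⟩
  have hintegrand : ContMDiffOn ((𝓘(ℝ, ℝ).prod (stModel d)).prod 𝓘(ℝ, ℝ)) 𝓘(ℝ, E.F) ∞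
      (Function.uncurry fun (q : ℝ × Spacetime N) (r : ℝ) => trivVal E x₀ q.2 (s (r * q.1) q.2))
      ((univ ×ˢ trivDom E x₀) ×ˢ univ) := fun z hz =>
    (ContMDiffAt.comp z (g := fun q : ℝ × Spacetime N => trivVal E x₀ q.2 (s q.1 q.2))
      (hs.contMDiffAt_trivVal hz.1.2 (z.2 * z.1.1))
      ((contMDiffAt_snd.mul contMDiffAt_fst.fst).prodMk contMDiffAt_fst.snd)).contMDiffWithinAt
  refine ((contMDiffOn_setIntegral volume hU (isCompact_Icc (a := (0 : ℝ)) (b := 1))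
    hintegrand).contMDiffAt (hU.mem_nhds hmem)).congr_of_eventuallyEq ?_
  filter_upwards [hU.mem_nhds hmem] with q hq
  exact ((trivEquiv E hq.2).integral_comp_comm _).symm

end SmoothField

namespace SmoothFamily

theorem smoothField {φ : P → Sec E} (h : SmoothFamily φ) : SmoothField (fun p x => φ p x) :=
  h

theorem comp {Q : Type} [NormedAddCommGroup Q] [NormedSpace ℝ Q] {φ : P → Sec E}
    (h : SmoothFamily φ) {g : Q → P} (hg : ContDiff ℝ ∞ g) : SmoothFamily (fun q => φ (g q)) :=
  ContMDiff.comp (f := fun z : Q × Spacetime N => (g z.1, z.2)) h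
    ((hg.contMDiff.comp contMDiff_fst).prodMk contMDiff_snd)

theorem const (φ : Sec E) : SmoothFamily (fun _ : P => φ) :=
  ContMDiff.comp (g := fun x => (⟨x, φ x⟩ : TotalSpace E.F E.fib)) φ.contMDiff contMDiff_snd

theorem add {φ ψ : P → Sec E} (h : SmoothFamily φ) (h' : SmoothFamily ψ) :
    SmoothFamily (fun p => φ p + ψ p) :=
  h.smoothField.add h'.smoothField

theorem smul {φ : P → Sec E} (h : SmoothFamily φ) {f : P → ℝ} (hf : ContDiff ℝ ∞ f) :
    SmoothFamily (fun p => f p • φ p) :=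
  h.smoothField.smul (f := fun p _ => f p) (hf.contMDiff.comp contMDiff_fst)

theorem sub {φ ψ : P → Sec E} (h : SmoothFamily φ) (h' : SmoothFamily ψ) :
    SmoothFamily (fun p => φ p - ψ p) := by
  have hneg : (fun p => φ p - ψ p) = fun p => φ p + (-1 : ℝ) • ψ p := funext fun p => by module
  exact hneg ▸ h.add (h'.smul contDiff_const)

end SmoothFamily

end SmoothFields

/-! ### Calculus of smooth functionals -/

section Functionals

variable {B E : VBundle.{u, v} d N}

/-- Smoothness of a functional along finite-dimensional smooth families of fields. -/
def SmoothFunctional (F : Sec B → ℝ) : Prop :=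
  ∀ (P : Type) [NormedAddCommGroup P] [NormedSpace ℝ P] [FiniteDimensional ℝ P] (φ : P → Sec B),
    SmoothFamily φ → ContDiff ℝ ∞ (fun p => F (φ p))

/-- The derivative of the functional `F` along the vector field `X` on the space of fields. -/
def lieDeriv (X : Sec B → Sec B) (F : Sec B → ℝ) : Sec B → ℝ :=
  fun ψ => dirDeriv F ψ (X ψ)

/-- The second derivative of the functional `F` at `φ` in the directions `X` and `Y`. -/
def dirDeriv₂ (F : Sec B → ℝ) (φ X Y : Sec B) : ℝ :=
  dirDeriv (fun ψ => dirDeriv F ψ Y) φ X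

-- The library forms of these two do not unify with the module structure of `Sec E`.
@[simp] theorem sec_zero_smul (X : Sec E) : (0 : ℝ) • X = 0 :=
  zero_smul ℝ X

@[simp] theorem sec_smul_zero (t : ℝ) : t • (0 : Sec E) = 0 := by
  ext x
  exact smul_zero t

theorem smoothFamily_line (φ X : Sec B) : SmoothFamily (fun s : ℝ => φ + s • X) :=
  (SmoothFamily.const φ).add ((SmoothFamily.const X).smul contDiff_id)

theorem smoothFamily_plane (φ X Y : Sec B) :
    SmoothFamily (fun q : ℝ × ℝ => φ + q.1 • X + q.2 • Y) :=
  ((smoothFamily_line φ X).comp contDiff_fst).add ((SmoothFamily.const Y).smul contDiff_snd)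

theorem hasVelocity_line (φ X : Sec B) : HasVelocity (fun s : ℝ => φ + s • X) X := fun x => by
  simpa using ((hasDerivAt_id (0 : ℝ)).smul_const (X x)).const_add (φ x)

theorem SmoothMap.const (X : Sec E) : SmoothMap (fun _ : Sec B => X) :=
  fun _ _ _ _ _ _ => SmoothFamily.const X

theorem SmoothMap.line {X : Sec B → Sec E} (hX : SmoothMap X) (φ Y : Sec B) :
    SmoothFamily (fun s : ℝ => X (φ + s • Y)) :=
  hX ℝ _ (smoothFamily_line φ Y)

theorem SmoothFunctional.sub {F G : Sec B → ℝ} (hF : SmoothFunctional F)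
    (hG : SmoothFunctional G) : SmoothFunctional (fun ψ => F ψ - G ψ) :=
  fun P _ _ _ φ hφ => (hF P φ hφ).sub (hG P φ hφ)

variable [IsManifold (𝓡 d) ∞ N]

/-- The velocity at `s = 0` of a smooth curve of sections. -/
def SmoothFamily.velocity {c : ℝ → Sec E} (hc : SmoothFamily c) : Sec E :=
  (hc.smoothField.fderiv_apply 1).sec 0

theorem SmoothFamily.hasVelocity {c : ℝ → Sec E} (hc : SmoothFamily c) :
    HasVelocity c hc.velocity := fun x =>
  ((hc.smoothField.contDiff_apply x).differentiable (by simp) 0).hasDerivAt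

/-- The derivative of a smooth map `X : Γ(B) → Γ(E)` at `φ` in the direction `Y`. -/
def SmoothMap.dir {X : Sec B → Sec E} (hX : SmoothMap X) (φ Y : Sec B) : Sec E :=
  (hX.line φ Y).velocity

theorem SmoothFamily.exists_eq_add_smul {c : ℝ → Sec E} (hc : SmoothFamily c) :
    ∃ g : ℝ → Sec E, SmoothFamily g ∧ (∀ t, c t = c 0 + t • g t) ∧
      ∀ X, HasVelocity c X → g 0 = X := by
  have hg := (hc.smoothField.fderiv_apply 1).unitIntervalIntegral
  refine ⟨hg.sec, hg.smoothFamily_sec, fun t => ?_, fun X hX => ?_⟩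
  · ext x
    have : CompleteSpace (E.fib x) := FiniteDimensional.complete ℝ _
    have hcx := hc.smoothField.contDiff_apply x
    have hcont : Continuous (deriv fun t => c t x) := hcx.continuous_deriv (by simp)
    have hftc : t • ∫ r in Icc (0 : ℝ) 1, deriv (fun t => c t x) (r * t) = c t x - c 0 x := by
      rw [integral_Icc_eq_integral_Ioc, ← intervalIntegral.integral_of_le zero_le_one]
      simpa using intervalIntegral.integral_unitInterval_deriv_eq_sub (𝕜 := ℝ) (z₀ := 0) (z₁ := t)
        (f := fun t => c t x) (by fun_prop)
        (fun r _ => (hcx.differentiable (by simp) _).hasDerivAt)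
    exact (add_eq_of_eq_sub' hftc).symm
  · ext x
    have : CompleteSpace (E.fib x) := FiniteDimensional.complete ℝ _
    change ∫ r in Icc (0 : ℝ) 1, deriv (fun t => c t x) (r * 0) = X x
    simp [(hX x).deriv]

namespace SmoothFunctional

variable {F : Sec B → ℝ} (hF : SmoothFunctional F)

include hF

theorem hasDerivAt {c : ℝ → Sec B} (hc : SmoothFamily c) {X : Sec B} (hX : HasVelocity c X) :
    HasDerivAt (fun t => F (c t)) (dirDeriv F (c 0) X) 0 := by
  obtain ⟨g, hg, hcg, hg0⟩ := hc.exists_eq_add_smul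
  have hsurface : SmoothFamily (fun q : ℝ × ℝ => c 0 + q.1 • g q.2) :=
    (SmoothFamily.const _).add ((hg.comp contDiff_snd).smul contDiff_fst)
  have hdiff : Differentiable ℝ (fun q : ℝ × ℝ => F (c 0 + q.1 • g q.2)) :=
    (hF _ _ hsurface).differentiable (by simp)
  have hline : HasDerivAt (fun t : ℝ => F (c 0 + t • g 0)) (dirDeriv F (c 0) X) 0 := by
    rw [← hg0 X hX]
    exact ((hF _ _ (smoothFamily_line (c 0) (g 0))).differentiable (by simp) 0).hasDerivAt
  have hconst : HasDerivAt (fun t : ℝ => F (c 0 + (0 : ℝ) • g t)) 0 0 := by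
    simpa using hasDerivAt_const (0 : ℝ) (F (c 0))
  simpa only [← hcg, add_zero] using hasDerivAt_diag (hdiff 0) hline hconst

theorem hasDerivAt_line (φ X : Sec B) :
    HasDerivAt (fun s : ℝ => F (φ + s • X)) (dirDeriv F φ X) 0 := by
  simpa using hF.hasDerivAt (smoothFamily_line φ X) (hasVelocity_line φ X)

section

variable {P : Type} [NormedAddCommGroup P] [NormedSpace ℝ P] [FiniteDimensional ℝ P]

theorem fderiv_family {Φ : P → Sec B} (hΦ : SmoothFamily Φ) {p v : P} {X : Sec B}
    (hX : HasVelocity (fun t : ℝ => Φ (p + t • v)) X) :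
    fderiv ℝ (fun p => F (Φ p)) p v = dirDeriv F (Φ p) X := by
  have hcurve : SmoothFamily (fun t : ℝ => Φ (p + t • v)) :=
    hΦ.comp (contDiff_const.add (contDiff_id.smul contDiff_const))
  have hchain := hF.hasDerivAt hcurve hX
  have hfderiv : HasFDerivAt (fun p => F (Φ p)) (fderiv ℝ (fun p => F (Φ p)) p) p :=
    ((hF _ _ hΦ).differentiable (by simp) p).hasFDerivAt
  rw [zero_smul, add_zero] at hchain
  exact (hfderiv.hasLineDerivAt v).unique hchain

theorem contDiff_dirDeriv {φ X : P → Sec B} (hφ : SmoothFamily φ) (hX : SmoothFamily X) :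
    ContDiff ℝ ∞ (fun p => dirDeriv F (φ p) (X p)) := by
  have hlines : SmoothFamily (fun q : P × ℝ => φ q.1 + q.2 • X q.1) :=
    (hφ.comp contDiff_fst).add ((hX.comp contDiff_fst).smul contDiff_snd)
  have hpartial (p : P) : fderiv ℝ (fun q : P × ℝ => F (φ q.1 + q.2 • X q.1)) (p, 0) (0, 1) =
      dirDeriv F (φ p) (X p) := by
    simpa using hF.fderiv_family (p := (p, 0)) (v := (0, 1)) (X := X p) hlines
      (by simpa using hasVelocity_line (φ p) (X p))
  have hfderiv : ContDiff ℝ ∞ (fderiv ℝ (fun q : P × ℝ => F (φ q.1 + q.2 • X q.1))) :=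
    (hF _ _ hlines).fderiv_right (by simp)
  simp only [← hpartial]
  exact (hfderiv.comp (contDiff_id.prodMk contDiff_const)).clm_apply contDiff_const

end

theorem lieDeriv {X : Sec B → Sec B} (hX : SmoothMap X) : SmoothFunctional (lieDeriv X F) :=
  fun P _ _ _ φ hφ => hF.contDiff_dirDeriv hφ (hX P φ hφ)

theorem dirDeriv_const (X : Sec B) : SmoothFunctional (fun ψ => dirDeriv F ψ X) :=
  hF.lieDeriv (.const X)

theorem dirDeriv_fixed (φ : Sec B) : SmoothFunctional (fun X => dirDeriv F φ X) :=
  fun _ _ _ _ _ hX => hF.contDiff_dirDeriv (.const φ) hX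

theorem fderiv_plane (φ X Y : Sec B) (p v : ℝ × ℝ) :
    fderiv ℝ (fun q : ℝ × ℝ => F (φ + q.1 • X + q.2 • Y)) p v =
      dirDeriv F (φ + p.1 • X + p.2 • Y) (v.1 • X + v.2 • Y) := by
  refine hF.fderiv_family (smoothFamily_plane φ X Y) ?_
  convert! hasVelocity_line (φ + p.1 • X + p.2 • Y) (v.1 • X + v.2 • Y) using 2 with t
  simp only [Prod.fst_add, Prod.snd_add, Prod.smul_fst, Prod.smul_snd, smul_eq_mul]
  module

theorem dirDeriv_linear_combination (φ X Y : Sec B) (r s : ℝ) :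
    dirDeriv F φ (r • X + s • Y) = r * dirDeriv F φ X + s * dirDeriv F φ Y := by
  have hplane (v : ℝ × ℝ) : fderiv ℝ (fun q : ℝ × ℝ => F (φ + q.1 • X + q.2 • Y)) 0 v =
      dirDeriv F φ (v.1 • X + v.2 • Y) := by
    simpa using hF.fderiv_plane φ X Y 0 v
  have hX := hplane (1, 0)
  have hY := hplane (0, 1)
  simp only [one_smul, sec_zero_smul, add_zero, zero_add] at hX hY
  rw [← hplane (r, s), ← hX, ← hY, ← smul_eq_mul, ← smul_eq_mul, ← map_smul, ← map_smul,
    ← map_add]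
  simp

theorem dirDeriv_add (φ X Y : Sec B) :
    dirDeriv F φ (X + Y) = dirDeriv F φ X + dirDeriv F φ Y := by
  simpa using hF.dirDeriv_linear_combination φ X Y 1 1

theorem dirDeriv_smul (φ X : Sec B) (t : ℝ) : dirDeriv F φ (t • X) = t * dirDeriv F φ X := by
  simpa using hF.dirDeriv_linear_combination φ X 0 t 0

theorem dirDeriv_sub (φ X Y : Sec B) :
    dirDeriv F φ (X - Y) = dirDeriv F φ X - dirDeriv F φ Y := by
  rw [eq_sub_iff_add_eq, ← hF.dirDeriv_add, sub_add_cancel]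

theorem dirDeriv_sub_functional {G : Sec B → ℝ} (hG : SmoothFunctional G) (φ X : Sec B) :
    dirDeriv (fun ψ => F ψ - G ψ) φ X = dirDeriv F φ X - dirDeriv G φ X :=
  ((hF.hasDerivAt_line φ X).sub (hG.hasDerivAt_line φ X)).deriv

theorem dirDeriv₂_sub_left (φ X X' Y : Sec B) :
    dirDeriv₂ F φ (X - X') Y = dirDeriv₂ F φ X Y - dirDeriv₂ F φ X' Y :=
  (hF.dirDeriv_const Y).dirDeriv_sub φ X X'

theorem dirDeriv₂_comm (φ X Y : Sec B) : dirDeriv₂ F φ X Y = dirDeriv₂ F φ Y X := by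
  let f : ℝ × ℝ → ℝ := fun q => F (φ + q.1 • X + q.2 • Y)
  have hf : ContDiff ℝ ∞ f := hF _ _ (smoothFamily_plane φ X Y)
  have hf' : Differentiable ℝ (fderiv ℝ f) :=
    (hf.fderiv_right (m := ∞) (by simp)).differentiable (by simp)
  have hsecond (v w : ℝ × ℝ) : fderiv ℝ (fderiv ℝ f) 0 v w =
      dirDeriv₂ F φ (v.1 • X + v.2 • Y) (w.1 • X + w.2 • Y) := by
    have houter := (hF.dirDeriv_const (w.1 • X + w.2 • Y)).fderiv_plane φ X Y 0 v
    simp only [← hF.fderiv_plane φ X Y _ w] at houter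
    rw [fderiv_clm_apply (hf' _) (differentiableAt_const _)] at houter
    simpa [dirDeriv₂] using houter
  have hsymm : IsSymmSndFDerivAt ℝ f 0 := hf.contDiffAt.isSymmSndFDerivAt
    (minSmoothness_of_isRCLikeNormedField.trans_le (WithTop.coe_le_coe.2 le_top))
  simpa [hsecond] using hsymm (1, 0) (0, 1)

theorem dirDeriv₂_sub_right (φ X Y Y' : Sec B) :
    dirDeriv₂ F φ X (Y - Y') = dirDeriv₂ F φ X Y - dirDeriv₂ F φ X Y' := by
  simp only [hF.dirDeriv₂_comm φ X, hF.dirDeriv₂_sub_left]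

theorem hasDerivAt_dirDeriv (φ : Sec B) {c : ℝ → Sec B} (hc : SmoothFamily c) {X : Sec B}
    (hX : HasVelocity c X) : HasDerivAt (fun t => dirDeriv F φ (c t)) (dirDeriv F φ X) 0 := by
  have hlinear : dirDeriv (fun Y => dirDeriv F φ Y) (c 0) X = dirDeriv F φ X := by
    refine HasDerivAt.deriv (𝕜 := ℝ) ?_
    simp only [hF.dirDeriv_add, hF.dirDeriv_smul]
    simpa using ((hasDerivAt_id (0 : ℝ)).mul_const (dirDeriv F φ X)).const_add
      (dirDeriv F φ (c 0))
  exact hlinear ▸ (hF.dirDeriv_fixed φ).hasDerivAt hc hX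

theorem dirDeriv_lieDeriv {X : Sec B → Sec B} (hX : SmoothMap X) (φ Y : Sec B) :
    dirDeriv (CovariantBracket.lieDeriv X F) φ Y =
      dirDeriv₂ F φ Y (X φ) + dirDeriv F φ (hX.dir φ Y) := by
  have hsmooth : ContDiff ℝ ∞ (fun q : ℝ × ℝ => dirDeriv F (φ + q.1 • Y) (X (φ + q.2 • Y))) :=
    hF.contDiff_dirDeriv ((smoothFamily_line φ Y).comp contDiff_fst)
      ((hX.line φ Y).comp contDiff_snd)
  refine (hasDerivAt_diag (hsmooth.differentiable (by simp) 0) ?_ ?_).deriv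
  · simpa [dirDeriv₂] using (hF.dirDeriv_const (X φ)).hasDerivAt_line φ Y
  · simpa [SmoothMap.dir] using hF.hasDerivAt_dirDeriv φ (hX.line φ Y) (hX.line φ Y).hasVelocity

end SmoothFunctional

end Functionals

/-! ### Supports and locality -/

section Locality

variable {B E E' E'' : VBundle.{u, v} d N}

theorem isClosed_supp (s : Sec E) : IsClosed (supp s) :=
  isClosed_closure

theorem eq_zero_of_notMem_supp {s : Sec E} {x : Spacetime N} (hx : x ∉ supp s) : s x = 0 :=
  not_not.1 fun h => hx (subset_closure h)

theorem eventually_eq_zero_of_notMem_supp {s : Sec E} {x : Spacetime N} (hx : x ∉ supp s) :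
    ∀ᶠ y in 𝓝 x, s y = (0 : Sec E) y := by
  filter_upwards [(isClosed_supp s).isOpen_compl.mem_nhds hx] with y hy
    using eq_zero_of_notMem_supp hy

theorem supp_subset {s : Sec E} {K : Set (Spacetime N)} (hK : IsClosed K)
    (h : ∀ x ∉ K, s x = 0) : supp s ⊆ K :=
  closure_minimal (fun x hx => not_not.1 fun hxK => hx (h x hxK)) hK

theorem supp_sub_subset (s t : Sec E) : supp (s - t) ⊆ supp s ∪ supp t := by
  refine supp_subset ((isClosed_supp s).union (isClosed_supp t)) fun x hx => ?_
  rw [mem_union, not_or] at hx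
  change s x - t x = 0
  rw [eq_zero_of_notMem_supp hx.1, eq_zero_of_notMem_supp hx.2, sub_zero]

theorem sameJet_of_eventually_eq {s t : Sec E} {x : Spacetime N} (h : ∀ᶠ y in 𝓝 x, s y = t y)
    (n : ℕ) : SameJet n s t x := by
  intro k _
  have hchart : Tendsto (extChartAt (stModel d) x).symm (𝓝 (extChartAt (stModel d) x x)) (𝓝 x) := by
    simpa only [ContinuousAt, extChartAt_to_inv] using
      continuousAt_extChartAt_symm (I := stModel d) x
  have hrep : localRep s x =ᶠ[𝓝 (extChartAt (stModel d) x x)] localRep t x := by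
    filter_upwards [hchart.eventually h] with y hy
    simp only [localRep, hy]
  exact (hrep.iteratedFDeriv ℝ k).eq_of_nhds

theorem IsLocalSection.congr {T : Sec B → Sec E} (hT : IsLocalSection T) {φ ψ : Sec B}
    {x : Spacetime N} (h : ∀ᶠ y in 𝓝 x, φ y = ψ y) : T φ x = T ψ x :=
  hT.1.elim fun n hn => hn φ ψ x (sameJet_of_eventually_eq h n)

theorem IsLocalOp.congr {P : Sec B → Sec E →ₗ[ℝ] Sec E'} (hP : IsLocalOp P) {φ ψ : Sec B}
    {a b : Sec E} {x : Spacetime N} (hφ : ∀ᶠ y in 𝓝 x, φ y = ψ y) (ha : ∀ᶠ y in 𝓝 x, a y = b y) :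
    P φ a x = P ψ b x :=
  hP.1.elim fun n hn => hn φ ψ a b x (sameJet_of_eventually_eq hφ n) (sameJet_of_eventually_eq ha n)

theorem IsLocalOp.congr_right {P : Sec B → Sec E →ₗ[ℝ] Sec E'} (hP : IsLocalOp P) (φ : Sec B)
    {a b : Sec E} {x : Spacetime N} (h : ∀ᶠ y in 𝓝 x, a y = b y) : P φ a x = P φ b x :=
  hP.congr (.of_forall fun _ => rfl) h

theorem IsLocalBiop.congr {P : Sec B → Sec E →ₗ[ℝ] Sec E' →ₗ[ℝ] Sec E''} (hP : IsLocalBiop P)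
    (φ : Sec B) {a b : Sec E} {a' b' : Sec E'} {x : Spacetime N}
    (ha : ∀ᶠ y in 𝓝 x, a y = b y) (ha' : ∀ᶠ y in 𝓝 x, a' y = b' y) : P φ a a' x = P φ b b' x :=
  hP.1.elim fun n hn => hn φ φ a b a' b' x (sameJet_of_eventually_eq (.of_forall fun _ => rfl) n)
    (sameJet_of_eventually_eq ha n) (sameJet_of_eventually_eq ha' n)

theorem IsLocalOp.supp_subset {P : Sec B → Sec E →ₗ[ℝ] Sec E'} (hP : IsLocalOp P) (φ : Sec B)
    (a : Sec E) : supp (P φ a) ⊆ supp a :=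
  CovariantBracket.supp_subset (isClosed_supp a) fun x hx => by
    rw [hP.congr_right φ (eventually_eq_zero_of_notMem_supp hx), map_zero]
    rfl

theorem IsLocalBiop.supp_subset_left {P : Sec B → Sec E →ₗ[ℝ] Sec E' →ₗ[ℝ] Sec E''}
    (hP : IsLocalBiop P) (φ : Sec B) (a : Sec E) (b : Sec E') : supp (P φ a b) ⊆ supp a :=
  supp_subset (isClosed_supp a) fun x hx => by
    rw [hP.congr φ (b' := b) (eventually_eq_zero_of_notMem_supp hx) (.of_forall fun _ => rfl),
      map_zero]
    rfl

theorem IsLocalBiop.supp_subset_right {P : Sec B → Sec E →ₗ[ℝ] Sec E' →ₗ[ℝ] Sec E''}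
    (hP : IsLocalBiop P) (φ : Sec B) (a : Sec E) (b : Sec E') : supp (P φ a b) ⊆ supp b :=
  supp_subset (isClosed_supp b) fun x hx => by
    rw [hP.congr φ (b := a) (.of_forall fun _ => rfl) (eventually_eq_zero_of_notMem_supp hx),
      map_zero]
    rfl

theorem IsLocalOp.smoothMap {P : Sec B → Sec E →ₗ[ℝ] Sec E'} (hP : IsLocalOp P) (a : Sec E) :
    SmoothMap (fun φ => P φ a) :=
  fun Q _ _ _ φ hφ => hP.2 Q φ (fun _ => a) hφ (.const a)

theorem eventually_line_eq (φ : Sec B) {W W' : Sec B} {x : Spacetime N}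
    (h : ∀ᶠ y in 𝓝 x, W y = W' y) (s : ℝ) : ∀ᶠ y in 𝓝 x, (φ + s • W) y = (φ + s • W') y := by
  filter_upwards [h] with y hy
  change φ y + s • W y = φ y + s • W' y
  rw [hy]

variable [IsManifold (𝓡 d) ∞ N]

theorem SmoothMap.dir_apply {X : Sec B → Sec E} (hX : SmoothMap X) (φ Y : Sec B)
    (x : Spacetime N) : hX.dir φ Y x = deriv (fun s : ℝ => X (φ + s • Y) x) 0 :=
  rfl

theorem IsLocalSection.dir_congr {T : Sec B → Sec E} (hT : IsLocalSection T) (φ : Sec B)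
    {W W' : Sec B} {x : Spacetime N} (h : ∀ᶠ y in 𝓝 x, W y = W' y) :
    hT.2.dir φ W x = hT.2.dir φ W' x := by
  simp only [SmoothMap.dir_apply, hT.congr (eventually_line_eq φ h _)]

theorem IsLocalSection.supp_dir_subset {T : Sec B → Sec E} (hT : IsLocalSection T) (φ W : Sec B) :
    supp (hT.2.dir φ W) ⊆ supp W :=
  supp_subset (isClosed_supp W) fun x hx => by
    rw [hT.dir_congr φ (eventually_eq_zero_of_notMem_supp hx)]
    simp [SmoothMap.dir_apply]

theorem IsLocalOp.supp_dir_subset_arg {P : Sec B → Sec E →ₗ[ℝ] Sec E'} (hP : IsLocalOp P)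
    (a : Sec E) (φ Y : Sec B) : supp ((hP.smoothMap a).dir φ Y) ⊆ supp a :=
  CovariantBracket.supp_subset (isClosed_supp a) fun x hx => by
    have hzero (s : ℝ) : P (φ + s • Y) a x = 0 :=
      eq_zero_of_notMem_supp fun h => hx (hP.supp_subset _ a h)
    simp [SmoothMap.dir_apply, hzero]

theorem IsLocalOp.supp_dir_subset_dir {P : Sec B → Sec E →ₗ[ℝ] Sec E'} (hP : IsLocalOp P)
    (a : Sec E) (φ Y : Sec B) : supp ((hP.smoothMap a).dir φ Y) ⊆ supp Y :=
  CovariantBracket.supp_subset (isClosed_supp Y) fun x hx => by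
    have hconst (s : ℝ) : P (φ + s • Y) a x = P (φ + s • (0 : Sec B)) a x :=
      hP.congr (eventually_line_eq φ (eventually_eq_zero_of_notMem_supp hx) s)
        (.of_forall fun _ => rfl)
    simp [SmoothMap.dir_apply, hconst]

theorem SupportedIn.exists_supp_dir_subset {S : Set (Set (Spacetime N))}
    (hS : ∀ K ∈ S, IsClosed K) {X : Sec B → Sec E} (hX : SmoothMap X) (hXS : SupportedIn S X)
    (φ Y : Sec B) : ∃ K ∈ S, supp (hX.dir φ Y) ⊆ K := by
  obtain ⟨K, hK, hsupp⟩ := hXS ℝ _ (smoothFamily_line φ Y) 0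
  refine ⟨K, hK, supp_subset (hS K hK) fun x hx => ?_⟩
  have hzero : (fun s : ℝ => X (φ + s • Y) x) =ᶠ[𝓝 0] fun _ => 0 := by
    filter_upwards [hsupp] with s hs using eq_zero_of_notMem_supp fun hxs => hx (hs hxs)
  rw [SmoothMap.dir_apply, hzero.deriv_eq, deriv_const]

end Locality

section Supports

/-- The opposite choice between advanced and retarded. -/
def Dir.op : Dir → Dir
  | .adv => .ret
  | .ret => .adv

theorem spatiallyCompactSets.mono {K L : Set (Spacetime N)} (hK : K ∈ spatiallyCompactSets N)
    (hL : IsClosed L) (hLK : L ⊆ K) : L ∈ spatiallyCompactSets N := by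
  refine ⟨hL, fun t' t => ?_⟩
  rw [← inter_eq_self_of_subset_right hLK, inter_right_comm]
  exact (hK.2 t' t).inter_right hL

theorem spatiallyCompactSets.union {K L : Set (Spacetime N)} (hK : K ∈ spatiallyCompactSets N)
    (hL : L ∈ spatiallyCompactSets N) : K ∪ L ∈ spatiallyCompactSets N := by
  refine ⟨hK.1.union hL.1, fun t' t => ?_⟩
  rw [union_inter_distrib_right]
  exact (hK.2 t' t).union (hL.2 t' t)

namespace Dir

variable {σ : Dir} {K L : Set (Spacetime N)}

theorem mem_spatiallyCompactSets (hK : K ∈ σ.sets N) : K ∈ spatiallyCompactSets N := by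
  cases σ <;> exact hK.1

theorem isClosed (hK : K ∈ σ.sets N) : IsClosed K :=
  (mem_spatiallyCompactSets hK).1

theorem sets_mono (hK : K ∈ σ.sets N) (hL : IsClosed L) (hLK : L ⊆ K) : L ∈ σ.sets N := by
  cases σ <;> exact ⟨spatiallyCompactSets.mono hK.1 hL hLK, hK.2.imp fun _ ht => hLK.trans ht⟩

theorem sets_union (hK : K ∈ σ.sets N) (hL : L ∈ σ.sets N) : K ∪ L ∈ σ.sets N := by
  cases σ with
  | adv =>
    obtain ⟨⟨hK, t, ht⟩, ⟨hL, s, hs⟩⟩ := And.intro hK hL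
    exact ⟨spatiallyCompactSets.union hK hL, min t s, union_subset
      (ht.trans (ofPred_subset_ofPred.2 fun _ => (min_le_left t s).trans))
      (hs.trans (ofPred_subset_ofPred.2 fun _ => (min_le_right t s).trans))⟩
  | ret =>
    obtain ⟨⟨hK, t, ht⟩, ⟨hL, s, hs⟩⟩ := And.intro hK hL
    exact ⟨spatiallyCompactSets.union hK hL, max t s, union_subset
      (ht.trans (ofPred_subset_ofPred.2 fun _ => le_max_of_le_left))
      (hs.trans (ofPred_subset_ofPred.2 fun _ => le_max_of_le_right))⟩

theorem mem_sets_of_isCompact [T2Space N] (hK : IsCompact K) : K ∈ σ.sets N := by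
  have hspatial : K ∈ spatiallyCompactSets N := ⟨hK.isClosed, fun t' t => hK.inter_right
    ((isClosed_le continuous_const continuous_fst).inter
      (isClosed_le continuous_fst continuous_const))⟩
  cases σ with
  | adv =>
    obtain ⟨t, ht⟩ := (hK.image continuous_fst).bddBelow
    exact ⟨hspatial, t, fun x hx => ht ⟨x, hx, rfl⟩⟩
  | ret =>
    obtain ⟨t, ht⟩ := (hK.image continuous_fst).bddAbove
    exact ⟨hspatial, t, fun x hx => ht ⟨x, hx, rfl⟩⟩

theorem isCompact_inter_of_adv_of_ret (hK : K ∈ adv.sets N) (hL : L ∈ ret.sets N) :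
    IsCompact (K ∩ L) := by
  obtain ⟨⟨hK, t', ht'⟩, ⟨hL, t, ht⟩⟩ := And.intro hK hL
  have hslab : K ∩ L = K ∩ {x | t' ≤ x.1 ∧ x.1 ≤ t} ∩ L := by
    ext x
    exact ⟨fun h => ⟨⟨h.1, ht' h.1, ht h.2⟩, h.2⟩, fun h => ⟨h.1.1, h.2⟩⟩
  exact hslab ▸ (hK.2 t' t).inter_right hL.1

theorem isCompact_inter (hK : K ∈ σ.sets N) (hL : L ∈ σ.op.sets N) : IsCompact (K ∩ L) := by
  cases σ with
  | adv => exact isCompact_inter_of_adv_of_ret hK hL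
  | ret => exact inter_comm K L ▸ isCompact_inter_of_adv_of_ret hL hK

end Dir

end Supports

/-! ### The pairing of sections -/

section Pairing

variable {E : VBundle.{u, v} d N} {P : Type} [NormedAddCommGroup P] [NormedSpace ℝ P]

theorem contMDiff_ev {ζ : P → ∀ x, E.dual.fib x} {ξ : P → ∀ x, E.fib x} (hζ : SmoothField ζ)
    (hξ : SmoothField ξ) : ContMDiff (𝓘(ℝ, P).prod (stModel d)) 𝓘(ℝ, ℝ) ∞
      (Function.uncurry fun p x => ev (ζ p x) (ξ p x)) := fun q =>
  (contMDiffAt_totalSpace.1 (ContMDiff.clm_bundle_apply (F₁ := E.F) (E₁ := E.fib) (F₂ := ℝ)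
    (E₂ := Bundle.Trivial (Spacetime N) ℝ) (b := fun q : P × Spacetime N => q.2)
    (ϕ := fun q => ζ q.1 q.2) (v := fun q => ξ q.1 q.2) hζ hξ q)).2

theorem continuous_ev (ζ : Sec E.dual) (ξ : Sec E) : Continuous (fun x => ev (ζ x) (ξ x)) :=
  (contMDiff_ev (P := ℝ) (SmoothFamily.const ζ).smoothField
    (SmoothFamily.const ξ).smoothField).continuous.comp
      (by fun_prop : Continuous fun x => ((0 : ℝ), x))

theorem ev_zero_left {x : Spacetime N} (w : E.fib x) : ev (E := E) (0 : E.dual.fib x) w = 0 :=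
  rfl

theorem ev_zero_right {x : Spacetime N} (a : E.dual.fib x) : ev (E := E) a (0 : E.fib x) = 0 :=
  map_zero (show E.fib x →L[ℝ] ℝ from a)

theorem hasDerivAt_ev {x : Spacetime N} (a : E.dual.fib x) {w : ℝ → E.fib x} {w' : E.fib x} {t : ℝ}
    (hw : HasDerivAt w w' t) : HasDerivAt (fun s => ev (E := E) a (w s)) (ev (E := E) a w') t :=
  (show E.fib x →L[ℝ] ℝ from a).hasFDerivAt.comp_hasDerivAt t hw

theorem ev_eq_zero_of_notMem_supp {ζ : Sec E.dual} {x : Spacetime N} (hx : x ∉ supp ζ)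
    (w : E.fib x) : ev (ζ x) w = 0 := by
  rw [eq_zero_of_notMem_supp hx, ev_zero_left]

variable [MeasurableSpace N] (μ : Measure (Spacetime N))

theorem pair_congr {ζ ζ' : Sec E.dual} {ξ ξ' : ∀ x, E.fib x}
    (h : ∀ x, ev (ζ x) (ξ x) = ev (ζ' x) (ξ' x)) : pair μ ζ ξ = pair μ ζ' ξ' := by
  simp only [pair, h]

theorem pair_zero_right (ζ : Sec E.dual) : pair μ ζ (0 : ∀ x, E.fib x) = 0 := by
  simp [pair, ev_zero_right]

theorem pair_eq_setIntegral {K : Set (Spacetime N)} {ζ : Sec E.dual} (hζ : supp ζ ⊆ K)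
    (ξ : ∀ x, E.fib x) : pair μ ζ ξ = ∫ x in K, ev (ζ x) (ξ x) ∂μ :=
  (setIntegral_eq_integral_of_forall_compl_eq_zero fun x hx =>
    ev_eq_zero_of_notMem_supp (fun h => hx (hζ h)) (ξ x)).symm

variable [BorelSpace N] [T2Space N] [SecondCountableTopology N] [IsFiniteMeasureOnCompacts μ]

theorem integrable_ev {ζ : Sec E.dual} (hζ : IsCompact (supp ζ)) (ξ : Sec E) :
    Integrable (fun x => ev (ζ x) (ξ x)) μ :=
  (continuous_ev ζ ξ).integrable_of_hasCompactSupport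
    (HasCompactSupport.intro hζ fun x hx => ev_eq_zero_of_notMem_supp hx (ξ x))

variable [IsManifold (𝓡 d) ∞ N]

theorem contDiff_pair {ζ : P → Sec E.dual} {ξ : P → Sec E} (hζ : SmoothFamily ζ)
    (hξ : SmoothFamily ξ) {K : Set (Spacetime N)} (hK : IsCompact K) (hζK : ∀ p, supp (ζ p) ⊆ K) :
    ContDiff ℝ ∞ (fun p => pair μ (ζ p) (ξ p)) := by
  simp only [fun p => pair_eq_setIntegral μ (hζK p) (ξ p)]
  exact contDiffOn_univ.1 (contDiffOn_setIntegral_of_contMDiffOn μ isOpen_univ hK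
    (contMDiff_ev hζ.smoothField hξ.smoothField).contMDiffOn)

theorem hasDerivAt_pair {ζ : Sec E.dual} {ξ : ℝ → Sec E} (hξ : SmoothFamily ξ)
    (hζ : IsCompact (supp ζ)) :
    HasDerivAt (fun t => pair μ ζ (ξ t)) (pair μ ζ hξ.velocity) 0 := by
  have hsmooth := contMDiff_ev (SmoothFamily.const (P := ℝ) ζ).smoothField hξ.smoothField
  have hfderiv := hasFDerivAt_setIntegral_of_contMDiffOn μ isOpen_univ hζ
    hsmooth.contMDiffOn (mem_univ 0)
  have hvelocity (x : Spacetime N) :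
      ev (ζ x) (hξ.velocity x) = fderiv ℝ (fun t => ev (ζ x) (ξ t x)) 0 1 :=
    (hasDerivAt_ev (ζ x) (hξ.hasVelocity x)).deriv.symm
  have hcont : Continuous (fun x => fderiv ℝ (fun t => ev (ζ x) (ξ t x)) 0) :=
    continuous_iff_continuousAt.2 fun x =>
      ContinuousAt.comp (f := fun x : Spacetime N => ((0 : ℝ), x)) (x := x)
        (contMDiffAt_fderiv_param (hsmooth (0, x))).continuousAt (by fun_prop)
  have hintegral := ContinuousLinearMap.integral_apply
    (hcont.continuousOn.integrableOn_compact' (μ := μ) hζ hζ.measurableSet) 1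
  simp only [pair_eq_setIntegral μ Subset.rfl, hvelocity]
  rw [← hintegral]
  exact hfderiv.hasDerivAt

end Pairing

/-! ### Cutoff functions -/

section Cutoffs

variable (d N) in
/-- Smooth functions on the space-time with compact support, used to cut off test sections. -/
structure Cutoff where
  toFun : Spacetime N → ℝ
  smooth : ContMDiff (stModel d) 𝓘(ℝ, ℝ) ∞ toFun
  compact : HasCompactSupport toFun

instance : CoeFun (Cutoff d N) fun _ => Spacetime N → ℝ :=
  ⟨Cutoff.toFun⟩

/-- The cutoff function is equal to `1` in a neighbourhood of `L`. -/
def Cutoff.OneNear (χ : Cutoff d N) (L : Set (Spacetime N)) : Prop :=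
  ∀ᶠ y in 𝓝ˢ L, χ y = 1

variable (d N) in
/-- The filter of the cutoff functions equal to `1` near larger and larger compact sets, along which
compactly supported cutoffs of a section exhaust it. -/
def cutoffs : Filter (Cutoff d N) where
  sets := {S | ∃ L, IsCompact L ∧ ∀ χ : Cutoff d N, χ.OneNear L → χ ∈ S}
  univ_sets := ⟨∅, isCompact_empty, fun _ _ => mem_univ _⟩
  sets_of_superset := fun ⟨L, hL, h⟩ hST => ⟨L, hL, fun χ hχ => hST (h χ hχ)⟩
  inter_sets := fun ⟨L, hL, h⟩ ⟨L', hL', h'⟩ =>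
    ⟨L ∪ L', hL.union hL', fun χ hχ =>
      ⟨h χ (hχ.filter_mono (nhdsSet_mono subset_union_left)),
        h' χ (hχ.filter_mono (nhdsSet_mono subset_union_right))⟩⟩

variable {E : VBundle.{u, v} d N}

instance : SMul (Cutoff d N) (Sec E) :=
  ⟨fun χ s => ⟨fun x => χ x • s x, χ.smooth.smul_section s.contMDiff⟩⟩

namespace Cutoff

theorem smul_apply (χ : Cutoff d N) (s : Sec E) (x : Spacetime N) : (χ • s) x = χ x • s x :=
  rfl

theorem smul_eq_zero (χ : Cutoff d N) {s : Sec E} {x : Spacetime N} (hx : x ∉ supp s) :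
    (χ • s) x = 0 := by
  rw [smul_apply, eq_zero_of_notMem_supp hx, smul_zero]

theorem isCompact_supp_smul [T2Space N] (χ : Cutoff d N) (s : Sec E) : IsCompact (supp (χ • s)) :=
  χ.compact.of_isClosed_subset (isClosed_supp _) (supp_subset (isClosed_tsupport _) fun x hx => by
    rw [smul_apply, image_eq_zero_of_notMem_tsupport hx, zero_smul])

theorem OneNear.eventually_smul_eq {χ : Cutoff d N} {L : Set (Spacetime N)} {s : Sec E}
    (h : χ.OneNear (L ∩ supp s)) {x : Spacetime N} (hx : x ∈ L) :
    ∀ᶠ y in 𝓝 x, (χ • s) y = s y := by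
  by_cases hxs : x ∈ supp s
  · filter_upwards [eventually_nhdsSet_iff_forall.1 h x ⟨hx, hxs⟩] with y hy
    rw [smul_apply, hy, one_smul]
  · filter_upwards [(isClosed_supp s).isOpen_compl.mem_nhds hxs] with y hy
    rw [χ.smul_eq_zero hy, eq_zero_of_notMem_supp hy]

end Cutoff

theorem eventually_smul_eq {L : Set (Spacetime N)} {s : Sec E} (hL : IsCompact (L ∩ supp s)) :
    ∀ᶠ χ in cutoffs d N, ∀ x ∈ L, ∀ᶠ y in 𝓝 x, (χ • s) y = s y :=
  ⟨L ∩ supp s, hL, fun _ hχ _ hx => hχ.eventually_smul_eq hx⟩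

theorem eventually_smul_eq_of_isCompact {L : Set (Spacetime N)} (hL : IsCompact L) (s : Sec E) :
    ∀ᶠ χ in cutoffs d N, ∀ x ∈ L, ∀ᶠ y in 𝓝 x, (χ • s) y = s y :=
  eventually_smul_eq (hL.inter_right (isClosed_supp s))

variable [T2Space N] [SecondCountableTopology N] [IsManifold (𝓡 d) ∞ N]

theorem exists_cutoff {L U : Set (Spacetime N)} (hL : IsCompact L) (hU : IsOpen U) (hLU : L ⊆ U) :
    ∃ χ : Cutoff d N, χ.OneNear L ∧ tsupport χ ⊆ U ∧ ∀ x, 0 ≤ χ x := by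
  have : LocallyCompactSpace N := ChartedSpace.locallyCompactSpace (EuclideanSpace ℝ (Fin d)) N
  obtain ⟨K, hK, hLK, hKU⟩ := exists_compact_between hL hU hLU
  obtain ⟨f, h1, h0, hf⟩ := exists_contMDiffMap_one_nhds_of_subset_interior (n := ⊤) (stModel d)
    hL.isClosed hLK
  have hs : tsupport f ⊆ K :=
    closure_minimal (fun x hx => by_contra fun h => hx (h0 x h)) hK.isClosed
  exact ⟨⟨f, f.contMDiff, hK.of_isClosed_subset (isClosed_tsupport _) hs⟩, h1, hs.trans hKU,
    fun x => (hf x).1⟩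

instance neBot_cutoffs : (cutoffs d N).NeBot := by
  refine ⟨fun h => ?_⟩
  obtain ⟨L, hL, hempty⟩ : ∅ ∈ cutoffs d N := h ▸ mem_bot
  obtain ⟨χ, hχ, -⟩ := exists_cutoff (d := d) hL isOpen_univ (subset_univ L)
  exact hempty χ hχ

theorem exists_sec_eq (x₀ : Spacetime N) (e : E.fib x₀) : ∃ s : Sec E, s x₀ = e := by
  obtain ⟨O, hO, hext⟩ := FiberBundle.exists_contMDiffOn_extend (k := ∞) (stModel d) E.F e
  obtain ⟨U, hUO, hU, hxU⟩ := mem_nhds_iff.1 hO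
  obtain ⟨χ, hχ, hχU, -⟩ := exists_cutoff (d := d) (isCompact_singleton (x := x₀)) hU
    (singleton_subset_iff.2 hxU)
  refine ⟨⟨χ.toFun • FiberBundle.extend E.F e, ContMDiffOn.smul_section_of_tsupport
    χ.smooth.contMDiffOn hU hχU (hext.mono hUO)⟩, ?_⟩
  change χ x₀ • FiberBundle.extend E.F e x₀ = e
  rw [(eventually_nhdsSet_iff_forall.1 hχ x₀ rfl).self_of_nhds, one_smul,
    FiberBundle.extend_apply_self]

variable [MeasurableSpace N] [BorelSpace N] (μ : Measure (Spacetime N))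
  [IsFiniteMeasureOnCompacts μ] [μ.IsOpenPosMeasure]

theorem exists_pair_smul_pos {ζ : Sec E.dual} {ξ : Sec E} {x₀ : Spacetime N}
    (h : 0 < ev (ζ x₀) (ξ x₀)) : ∃ χ : Cutoff d N, 0 < pair μ (χ • ζ) ξ := by
  obtain ⟨χ, hχ, hχU, hχ0⟩ := exists_cutoff (d := d) (isCompact_singleton (x := x₀))
    (isOpen_lt continuous_const (continuous_ev ζ ξ)) (singleton_subset_iff.2 h)
  have hev (x : Spacetime N) : ev ((χ • ζ) x) (ξ x) = χ x * ev (ζ x) (ξ x) := rfl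
  refine ⟨χ, (continuous_ev (χ • ζ) ξ).integral_pos_of_hasCompactSupport_nonneg_nonzero
    (HasCompactSupport.intro (χ.isCompact_supp_smul ζ) fun x hx =>
      ev_eq_zero_of_notMem_supp hx (ξ x)) (fun x => ?_) (x := x₀) ?_⟩
  · rw [Pi.zero_apply, hev]
    by_cases hx : x ∈ tsupport χ
    · exact mul_nonneg (hχ0 x) (le_of_lt (hχU hx))
    · rw [image_eq_zero_of_notMem_tsupport hx, zero_mul]
  · rw [hev, (eventually_nhdsSet_iff_forall.1 hχ x₀ rfl).self_of_nhds, one_mul]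
    exact h.ne'

theorem eq_zero_of_forall_pair_eq_zero {ξ : Sec E}
    (h : ∀ ζ : Sec E.dual, IsCompact (supp ζ) → pair μ ζ ξ = 0) : ξ = 0 := by
  ext x₀
  by_contra hx₀
  obtain ⟨α, -, hα⟩ := exists_dual_vector ℝ (ξ x₀) (norm_ne_zero_iff.2 hx₀)
  obtain ⟨ζ, hζ⟩ := exists_sec_eq (E := E.dual) x₀ α
  have hpos : 0 < ev (ζ x₀) (ξ x₀) := by
    rw [hζ]
    exact (norm_pos_iff.2 hx₀).trans_eq hα.symm
  obtain ⟨χ, hχ⟩ := exists_pair_smul_pos μ hpos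
  exact hχ.ne' (h _ (χ.isCompact_supp_smul ζ))

end Cutoffs

/-! ### Functionals with compactly supported derivatives -/

section Functionals

variable {B E : VBundle.{u, v} d N}

theorem SupportedIn.exists_at {S : Set (Set (Spacetime N))} {X : Sec B → Sec E}
    (h : SupportedIn S X) (φ : Sec B) : ∃ K ∈ S, supp (X φ) ⊆ K := by
  obtain ⟨K, hK, hs⟩ := h ℝ _ (SmoothFamily.const φ) 0
  exact ⟨K, hK, hs.self_of_nhds⟩

theorem SupportedIn.isCompact_supp [T2Space N] {X : Sec B → Sec E}
    (h : SupportedIn (compactSets N) X) (φ : Sec B) : IsCompact (supp (X φ)) := by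
  obtain ⟨K, hK, hs⟩ := h.exists_at φ
  exact IsCompact.of_isClosed_subset hK (isClosed_supp _) hs

variable [MeasurableSpace N] {μ : Measure (Spacetime N)} {A A' : Sec B → ℝ}

/-- The section `α` represents the derivative `δA` of the functional `A` at `φ`. -/
structure IsGradient (μ : Measure (Spacetime N)) (A : Sec B → ℝ) (φ : Sec B) (α : Sec B.dual) :
    Prop where
  isCompact_supp : IsCompact (supp α)
  dirDeriv_eq : ∀ X : Sec B, dirDeriv A φ X = pair μ α X

namespace IsFunctional

theorem smoothFunctional (hA : IsFunctional μ A) : SmoothFunctional A :=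
  hA.1

theorem exists_gradient (hA : IsFunctional μ A) :
    ∃ δA : Sec B → Sec B.dual, SupportedIn (compactSets N) δA ∧
      ∀ φ X, dirDeriv A φ X = pair μ (δA φ) X := by
  obtain ⟨-, δA, -, hsupp, hderiv⟩ := hA
  refine ⟨δA, hsupp, fun φ X => ?_⟩
  have hline := (hderiv _ X (smoothFamily_line φ X) (hasVelocity_line φ X)).deriv
  rwa [sec_zero_smul, add_zero] at hline

theorem exists_isGradient [T2Space N] (hA : IsFunctional μ A) (φ : Sec B) :
    ∃ α, IsGradient μ A φ α := by
  obtain ⟨δA, hsupp, hderiv⟩ := hA.exists_gradient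
  exact ⟨δA φ, hsupp.isCompact_supp φ, hderiv φ⟩

theorem exists_isCompact_dirDeriv_congr (hA : IsFunctional μ A) {c : ℝ → Sec B}
    (hc : SmoothFamily c) : ∃ K, IsCompact K ∧ ∀ᶠ s in 𝓝 (0 : ℝ), ∀ X X' : Sec B,
      (∀ x ∈ K, X x = X' x) → dirDeriv A (c s) X = dirDeriv A (c s) X' := by
  obtain ⟨δA, hsupp, hderiv⟩ := hA.exists_gradient
  obtain ⟨K, hK, hKs⟩ := hsupp ℝ c hc 0
  refine ⟨K, hK, hKs.mono fun s hs X X' hX => ?_⟩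
  rw [hderiv, hderiv]
  refine pair_congr μ fun x => ?_
  by_cases hx : x ∈ K
  · rw [hX x hx]
  · have hx' : x ∉ supp (δA (c s)) := fun h => hx (hs h)
    rw [ev_eq_zero_of_notMem_supp hx', ev_eq_zero_of_notMem_supp hx']

theorem eventually_dirDeriv_localOp (hA : IsFunctional μ A) {P : Sec B → Sec E →ₗ[ℝ] Sec B}
    (hP : IsLocalOp P) {c : ℝ → Sec B} (hc : SmoothFamily c) (a : Sec E) :
    ∀ᶠ χ in cutoffs d N, ∀ᶠ s in 𝓝 (0 : ℝ),
      dirDeriv A (c s) (P (c s) (χ • a)) = dirDeriv A (c s) (P (c s) a) := by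
  obtain ⟨K, hK, hAK⟩ := hA.exists_isCompact_dirDeriv_congr hc
  filter_upwards [eventually_smul_eq_of_isCompact hK a] with χ hχ
  filter_upwards [hAK] with s hs
  exact hs _ _ fun x hx => hP.congr_right _ (hχ x hx)

theorem exists_isCompact_dirDeriv_congr_at (hA : IsFunctional μ A) (φ : Sec B) :
    ∃ K, IsCompact K ∧ ∀ X X' : Sec B, (∀ x ∈ K, X x = X' x) →
      dirDeriv A φ X = dirDeriv A φ X' := by
  obtain ⟨K, hK, h⟩ := hA.exists_isCompact_dirDeriv_congr (SmoothFamily.const φ)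
  exact ⟨K, hK, h.self_of_nhds⟩

theorem sub [BorelSpace N] [T2Space N] [SecondCountableTopology N] [IsFiniteMeasureOnCompacts μ]
    (hA : IsFunctional μ A) (hA' : IsFunctional μ A') : IsFunctional μ (fun φ => A φ - A' φ) := by
  obtain ⟨hs, α, hα, hαK, h⟩ := hA
  obtain ⟨hs', α', hα', hαK', h'⟩ := hA'
  refine ⟨SmoothFunctional.sub hs hs', fun φ => α φ - α' φ,
    fun P _ _ _ φ hφ => (hα P φ hφ).sub (hα' P φ hφ), fun P _ _ _ φ hφ p => ?_,
    fun φ X hφ hX => ?_⟩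
  · obtain ⟨K, hK, hsupp⟩ := hαK P φ hφ p
    obtain ⟨K', hK', hsupp'⟩ := hαK' P φ hφ p
    refine ⟨K ∪ K', IsCompact.union hK hK', ?_⟩
    filter_upwards [hsupp, hsupp'] with q hq hq'
    exact (supp_sub_subset _ _).trans (union_subset_union hq hq')
  · convert! (h φ X hφ hX).sub (h' φ X hφ hX) using 1
    exact integral_sub (integrable_ev μ (hαK.isCompact_supp _) X)
      (integrable_ev μ (hαK'.isCompact_supp _) X)

end IsFunctional

end Functionals

/-! ### Lagrange multipliers and shell curves -/

namespace FieldTheory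

section Locality

variable {𝒯 : FieldTheory.{u, v} d N} {x : Spacetime N}

theorem J_congr {φ ψ : Sec 𝒯.B} (h : ∀ᶠ y in 𝓝 x, φ y = ψ y) (W : Sec 𝒯.B) :
    𝒯.J φ W x = 𝒯.J ψ W x := by
  have hline (s : ℝ) : 𝒯.T (φ + s • W) x = 𝒯.T (ψ + s • W) x := by
    refine 𝒯.T_local.congr ?_
    filter_upwards [h] with y hy
    change φ y + s • W y = ψ y + s • W y
    rw [hy]
  simp only [J, hline]

variable [IsManifold (𝓡 d) ∞ N]

theorem J_eq_dir (φ W : Sec 𝒯.B) : 𝒯.J φ W = 𝒯.T_local.2.dir φ W :=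
  rfl

theorem J_congr_right (φ : Sec 𝒯.B) {W W' : Sec 𝒯.B} (h : ∀ᶠ y in 𝓝 x, W y = W' y) :
    𝒯.J φ W x = 𝒯.J φ W' x :=
  𝒯.T_local.dir_congr φ h

theorem J_eq_zero_of_notMem_supp (φ : Sec 𝒯.B) {W : Sec 𝒯.B} (h : x ∉ supp W) : 𝒯.J φ W x = 0 :=
  eq_zero_of_notMem_supp fun hx => h (𝒯.T_local.supp_dir_subset φ W hx)

theorem J_V_congr (φ : Sec 𝒯.B) {a b : Sec 𝒯.E.dual} (h : ∀ᶠ y in 𝓝 x, a y = b y) :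
    𝒯.J φ (𝒯.V φ a) x = 𝒯.J φ (𝒯.V φ b) x :=
  J_congr_right φ <| by
    filter_upwards [eventually_eventually_nhds.2 h] with y hy using 𝒯.V_local.congr_right φ hy

end Locality

section ShellCurves

variable {𝒯 : FieldTheory.{u, v} d N}

variable (𝒯) in
/-- `γ` is a smooth curve in the shell that passes through `φ` with the velocity `Y`. -/
structure IsShellCurve (γ : ℝ → Sec 𝒯.B) (φ Y : Sec 𝒯.B) : Prop where
  smooth : SmoothFamily γ
  mem_shell : ∀ s, γ s ∈ 𝒯.shell
  zero : γ 0 = φ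
  velocity : HasVelocity γ Y

namespace IsShellCurve

variable [IsManifold (𝓡 d) ∞ N] {γ : ℝ → Sec 𝒯.B} {φ Y : Sec 𝒯.B} {F G : Sec 𝒯.B → ℝ}

theorem hasDerivAt (hγ : 𝒯.IsShellCurve γ φ Y) (hF : SmoothFunctional F) :
    HasDerivAt (fun s => F (γ s)) (dirDeriv F φ Y) 0 :=
  hγ.zero ▸ hF.hasDerivAt hγ.smooth hγ.velocity

theorem dirDeriv_congr (hγ : 𝒯.IsShellCurve γ φ Y) (hF : SmoothFunctional F)
    (hG : SmoothFunctional G) (h : ∀ᶠ s in 𝓝 (0 : ℝ), F (γ s) = G (γ s)) :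
    dirDeriv F φ Y = dirDeriv G φ Y :=
  (hγ.hasDerivAt hF).unique ((hγ.hasDerivAt hG).congr_of_eventuallyEq h)

theorem dirDeriv_eq_zero (hγ : 𝒯.IsShellCurve γ φ Y) (hF : SmoothFunctional F)
    (h : ∀ᶠ s in 𝓝 (0 : ℝ), F (γ s) = 0) : dirDeriv F φ Y = 0 :=
  (hγ.hasDerivAt hF).unique ((hasDerivAt_const 0 0).congr_of_eventuallyEq h)

end IsShellCurve

end ShellCurves

section Multipliers

variable [MeasurableSpace N] {μ : Measure (Spacetime N)} {𝒯 : FieldTheory.{u, v} d N} {σ : Dir}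
  {φ : Sec 𝒯.B} {A : Sec 𝒯.B → ℝ} {ζ : Sec 𝒯.E.dual}

variable (μ 𝒯) in
/-- The field equations contracted with the test section `b`, as a functional of the fields. -/
def test (b : Sec 𝒯.E.dual) (ψ : Sec 𝒯.B) : ℝ :=
  pair μ b (𝒯.T ψ)

variable (μ 𝒯) in
/-- The functional `A - b^a T_a`. If `b` is a cutoff of a Lagrange multiplier of `A` at `φ`, then
`φ` is a critical point of it with respect to variations of the fields where nothing is cut off. -/
def augmented (A : Sec 𝒯.B → ℝ) (b : Sec 𝒯.E.dual) (ψ : Sec 𝒯.B) : ℝ :=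
  A ψ - 𝒯.test μ b ψ

variable (μ 𝒯) in
/-- `ζ` is a Lagrange multiplier of `A` at `φ`: it represents the derivative of `A` in the form
`δA = J^* ζ`. Its support is opposite to that of fluctuations, so that it can be contracted with
their images under `J`. -/
structure IsMultiplier (σ : Dir) (φ : Sec 𝒯.B) (A : Sec 𝒯.B → ℝ) (ζ : Sec 𝒯.E.dual) : Prop where
  supp_mem : supp ζ ∈ σ.op.sets N
  dirDeriv_eq : ∀ h : Sec 𝒯.B, IsCompact (supp h) → dirDeriv A φ h = pair μ ζ (𝒯.J φ h)

theorem IsObservable.exists_isMultiplier [T2Space N] (hA : 𝒯.IsObservable μ A)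
    (hdual : 𝒯.IsDualExact μ σ.op) (hφ : φ ∈ 𝒯.shell) : ∃ ζ, 𝒯.IsMultiplier μ σ φ A ζ := by
  obtain ⟨α, hα⟩ := hA.1.exists_isGradient φ
  obtain ⟨ζ, hζ, hαζ⟩ := hdual φ hφ α (Dir.mem_sets_of_isCompact hα.isCompact_supp) fun ε hε => by
    rw [← hα.dirDeriv_eq, hA.2 φ hφ ε hε]
  exact ⟨ζ, hζ, fun h hh => by rw [hα.dirDeriv_eq, hαζ h hh]⟩

variable [IsManifold (𝓡 d) ∞ N] [BorelSpace N] [T2Space N] [SecondCountableTopology N]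
  [IsFiniteMeasureOnCompacts μ] {b : Sec 𝒯.E.dual}

theorem smoothFunctional_test (hb : IsCompact (supp b)) : SmoothFunctional (𝒯.test μ b) :=
  fun P _ _ _ ψ hψ =>
    contDiff_pair μ (SmoothFamily.const b) (𝒯.T_local.2 P ψ hψ) hb fun _ => Subset.rfl

theorem dirDeriv_test (hb : IsCompact (supp b)) (ψ W : Sec 𝒯.B) :
    dirDeriv (𝒯.test μ b) ψ W = pair μ b (𝒯.J ψ W) :=
  (hasDerivAt_pair μ (𝒯.T_local.2.line ψ W) hb).deriv

theorem smoothFunctional_augmented (hA : SmoothFunctional A) (hb : IsCompact (supp b)) :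
    SmoothFunctional (𝒯.augmented μ A b) :=
  hA.sub (smoothFunctional_test hb)

theorem dirDeriv_augmented (hA : SmoothFunctional A) (hb : IsCompact (supp b)) (ψ W : Sec 𝒯.B) :
    dirDeriv (𝒯.augmented μ A b) ψ W = dirDeriv A ψ W - pair μ b (𝒯.J ψ W) := by
  rw [← dirDeriv_test hb]
  exact hA.dirDeriv_sub_functional (smoothFunctional_test hb) ψ W

namespace IsMultiplier

theorem eventually_dirDeriv_augmented (hζ : 𝒯.IsMultiplier μ σ φ A ζ) (hA : IsFunctional μ A)
    {W : Sec 𝒯.B} (hW : supp W ∈ σ.sets N) :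
    ∀ᶠ χ in cutoffs d N, dirDeriv (𝒯.augmented μ A (χ • ζ)) φ W = 0 := by
  obtain ⟨K, hK, hAK⟩ := hA.exists_isCompact_dirDeriv_congr_at φ
  have hcompact := Dir.isCompact_inter hW hζ.supp_mem
  filter_upwards [eventually_smul_eq_of_isCompact hK W, eventually_smul_eq hcompact,
    eventually_smul_eq (inter_comm _ _ ▸ hcompact)] with χ hχK hχζ hχW
  have hswap : pair μ ζ (𝒯.J φ (χ • W)) = pair μ (χ • ζ) (𝒯.J φ W) := pair_congr μ fun x => by
    by_cases hxζ : x ∈ supp ζ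
    · rw [J_congr_right φ (hχW x hxζ)]
      by_cases hxW : x ∈ supp W
      · rw [(hχζ x hxW).self_of_nhds]
      · rw [J_eq_zero_of_notMem_supp φ hxW, ev_zero_right, ev_zero_right]
    · rw [χ.smul_eq_zero hxζ, eq_zero_of_notMem_supp hxζ, ev_zero_left, ev_zero_left]
  rw [dirDeriv_augmented hA.smoothFunctional (χ.isCompact_supp_smul ζ), ← hswap,
    ← hζ.dirDeriv_eq _ (χ.isCompact_supp_smul W), sub_eq_zero]
  exact hAK _ _ fun x hx => (hχK x hx).self_of_nhds.symm

theorem eventually_dirDeriv_lieDeriv (hζ : 𝒯.IsMultiplier μ σ φ A ζ) (hA : IsFunctional μ A)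
    {X : Sec 𝒯.B → Sec 𝒯.B} (hX : SmoothMap X) {Y : Sec 𝒯.B}
    (hXY : supp (hX.dir φ Y) ∈ σ.sets N) :
    ∀ᶠ χ in cutoffs d N, dirDeriv (lieDeriv X (𝒯.augmented μ A (χ • ζ))) φ Y =
      dirDeriv₂ (𝒯.augmented μ A (χ • ζ)) φ Y (X φ) := by
  filter_upwards [hζ.eventually_dirDeriv_augmented hA hXY] with χ hχ
  rw [(smoothFunctional_augmented hA.smoothFunctional (χ.isCompact_supp_smul ζ)).dirDeriv_lieDeriv
    hX, hχ, add_zero]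

end IsMultiplier

end Multipliers

end FieldTheory

/-! ### Fluctuations on shell -/

namespace FieldTheory

variable {𝒯 : FieldTheory.{u, v} d N}

theorem IsGaugeSymmetry.J_gauge (hgauge : 𝒯.IsGaugeSymmetry) {φ : Sec 𝒯.B} (hφ : φ ∈ 𝒯.shell)
    (ε : Sec 𝒯.G) : 𝒯.J φ (𝒯.R φ ε) = 0 := by
  obtain ⟨C, -, hC⟩ := hgauge
  have hT : 𝒯.T φ = 0 := hφ
  funext x
  rw [hC, hT, map_zero]
  rfl

variable (𝒯) in
/-- The vector field `V_a ζ^a` on the space of fields. -/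
def anchorField (ζ : Sec 𝒯.E.dual) (ψ : Sec 𝒯.B) : Sec 𝒯.B :=
  𝒯.V ψ ζ

theorem smoothMap_anchorField (ζ : Sec 𝒯.E.dual) : SmoothMap (𝒯.anchorField ζ) :=
  𝒯.V_local.smoothMap ζ

section Responses

variable [MeasurableSpace N] {μ : Measure (Spacetime N)} {σ : Dir}
  {φ : Sec 𝒯.B} {A H : Sec 𝒯.B → ℝ} {ζ : Sec 𝒯.E.dual} {z z' : Sec 𝒯.B}

variable (μ 𝒯) in
/-- `z` is a possible value at `φ` of a fluctuation caused by `A`. -/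
structure IsResponse (σ : Dir) (φ : Sec 𝒯.B) (A : Sec 𝒯.B → ℝ) (z : Sec 𝒯.B) : Prop where
  supp_mem : supp z ∈ σ.sets N
  pair_eq : ∀ b : Sec 𝒯.E.dual, IsCompact (supp b) →
    pair μ b (𝒯.J φ z) = dirDeriv A φ (𝒯.V φ b)

theorem IsFluctuation.isResponse {X : Sec 𝒯.B → Sec 𝒯.B} (hX : 𝒯.IsFluctuation μ σ A X)
    (hφ : φ ∈ 𝒯.shell) : 𝒯.IsResponse μ σ φ A (X φ) := by
  obtain ⟨K, hK, hs⟩ := hX.1.2.1.exists_at φ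
  exact ⟨Dir.sets_mono hK (isClosed_supp _) hs, hX.2 φ hφ⟩

variable [IsManifold (𝓡 d) ∞ N] [T2Space N] [SecondCountableTopology N]

theorem IsObservable.eventually_dirDeriv_gauge (hA : 𝒯.IsObservable μ A) {c : ℝ → Sec 𝒯.B}
    (hc : SmoothFamily c) (hcs : ∀ s, c s ∈ 𝒯.shell) (ε : Sec 𝒯.G) :
    ∀ᶠ s in 𝓝 (0 : ℝ), dirDeriv A (c s) (𝒯.R (c s) ε) = 0 := by
  obtain ⟨χ, hχ⟩ := (hA.1.eventually_dirDeriv_localOp 𝒯.R_local hc ε).exists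
  filter_upwards [hχ] with s hs
  rw [← hs, hA.2 _ (hcs s) _ (χ.isCompact_supp_smul ε)]

theorem IsObservable.dirDeriv_gauge (hA : 𝒯.IsObservable μ A) (hφ : φ ∈ 𝒯.shell) (ε : Sec 𝒯.G) :
    dirDeriv A φ (𝒯.R φ ε) = 0 :=
  (hA.eventually_dirDeriv_gauge (.const φ) (fun _ => hφ) ε).self_of_nhds

variable [BorelSpace N] [IsFiniteMeasureOnCompacts μ]

theorem eventually_dirDeriv₂_augmented_gauge (hgauge : 𝒯.IsGaugeSymmetry)
    (hA : 𝒯.IsObservable μ A) (hζ : 𝒯.IsMultiplier μ σ φ A ζ) {γ : ℝ → Sec 𝒯.B} {Y : Sec 𝒯.B}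
    (hγ : 𝒯.IsShellCurve γ φ Y) {ε : Sec 𝒯.G} (hε : supp ε ∈ σ.sets N) :
    ∀ᶠ χ in cutoffs d N, dirDeriv₂ (𝒯.augmented μ A (χ • ζ)) φ Y (𝒯.R φ ε) = 0 := by
  have hR := 𝒯.R_local.smoothMap ε
  filter_upwards [hζ.eventually_dirDeriv_lieDeriv hA.1 hR (Dir.sets_mono hε (isClosed_supp _)
    (𝒯.R_local.supp_dir_subset_arg ε φ Y))] with χ hχ
  have hcompact := χ.isCompact_supp_smul ζ
  rw [← hχ]
  refine hγ.dirDeriv_eq_zero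
    ((smoothFunctional_augmented hA.1.smoothFunctional hcompact).lieDeriv hR) ?_
  filter_upwards [hA.eventually_dirDeriv_gauge hγ.smooth hγ.mem_shell ε] with s hs
  rw [lieDeriv, dirDeriv_augmented hA.1.smoothFunctional hcompact, hs,
    hgauge.J_gauge (hγ.mem_shell s), pair_zero_right, sub_zero]

theorem IsMultiplier.dirDeriv_response (hζ : 𝒯.IsMultiplier μ σ φ A ζ) (hA : IsFunctional μ A)
    (hH : IsFunctional μ H) (hz : 𝒯.IsResponse μ σ φ H z) :
    dirDeriv A φ z = dirDeriv H φ (𝒯.V φ ζ) := by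
  obtain ⟨χ, hχA, hχH⟩ := ((hζ.eventually_dirDeriv_augmented hA hz.supp_mem).and
    (hH.eventually_dirDeriv_localOp 𝒯.V_local (.const φ) ζ)).exists
  have hcompact := χ.isCompact_supp_smul ζ
  rw [dirDeriv_augmented hA.smoothFunctional hcompact, sub_eq_zero] at hχA
  rw [hχA, hz.pair_eq _ hcompact, hχH.self_of_nhds]

variable [μ.IsOpenPosMeasure]

theorem J_sub_eq_zero (h : ∀ b : Sec 𝒯.E.dual, IsCompact (supp b) →
      pair μ b (𝒯.J φ z) = pair μ b (𝒯.J φ z')) (x : Spacetime N) :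
    𝒯.J φ (z - z') x = 0 := by
  have hdir : 𝒯.T_local.2.dir φ (z - z') = 0 := eq_zero_of_forall_pair_eq_zero μ fun b hb => by
    rw [← J_eq_dir, ← dirDeriv_test hb, (smoothFunctional_test hb).dirDeriv_sub, dirDeriv_test hb,
      dirDeriv_test hb, h b hb, sub_self]
  rw [J_eq_dir, hdir]
  rfl

theorem IsResponse.exists_sub_eq_gauge (hexact : 𝒯.IsExact σ) (hφ : φ ∈ 𝒯.shell)
    (hz : 𝒯.IsResponse μ σ φ H z) (hz' : 𝒯.IsResponse μ σ φ H z') :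
    ∃ ε : Sec 𝒯.G, supp ε ∈ σ.sets N ∧ z - z' = 𝒯.R φ ε :=
  hexact φ hφ (z - z')
    (Dir.sets_mono (Dir.sets_union hz.supp_mem hz'.supp_mem) (isClosed_supp _)
      (supp_sub_subset z z'))
    (J_sub_eq_zero fun b hb => by rw [hz.pair_eq b hb, hz'.pair_eq b hb])

theorem eventually_dirDeriv₂_augmented_response (hgauge : 𝒯.IsGaugeSymmetry)
    (hexact : 𝒯.IsExact σ) (hφ : φ ∈ 𝒯.shell) (hA : 𝒯.IsObservable μ A)
    (hζ : 𝒯.IsMultiplier μ σ φ A ζ) {γ : ℝ → Sec 𝒯.B} {Y : Sec 𝒯.B}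
    (hγ : 𝒯.IsShellCurve γ φ Y) (hz : 𝒯.IsResponse μ σ φ H z) (hz' : 𝒯.IsResponse μ σ φ H z') :
    ∀ᶠ χ in cutoffs d N, dirDeriv₂ (𝒯.augmented μ A (χ • ζ)) φ Y z =
      dirDeriv₂ (𝒯.augmented μ A (χ • ζ)) φ Y z' := by
  obtain ⟨ε, hε, hzε⟩ := hz.exists_sub_eq_gauge hexact hφ hz'
  filter_upwards [eventually_dirDeriv₂_augmented_gauge hgauge hA hζ hγ hε] with χ hχ
  rwa [← hzε, (smoothFunctional_augmented hA.1.smoothFunctional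
    (χ.isCompact_supp_smul ζ)).dirDeriv₂_sub_right, sub_eq_zero] at hχ

end Responses

section Fluctuations

variable [MeasurableSpace N] {μ : Measure (Spacetime N)} {σ : Dir}
  {φ : Sec 𝒯.B} {A B : Sec 𝒯.B → ℝ} {ζ : Sec 𝒯.E.dual} {X : Sec 𝒯.B → Sec 𝒯.B}
  [IsManifold (𝓡 d) ∞ N] [BorelSpace N] [T2Space N] [SecondCountableTopology N]
  [IsFiniteMeasureOnCompacts μ]

theorem IsFluctuation.eventually_lieDeriv_augmented (hX : 𝒯.IsFluctuation μ σ A X)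
    (hA : IsFunctional μ A) (hB : IsFunctional μ B) {c : ℝ → Sec 𝒯.B} (hc : SmoothFamily c)
    (hcs : ∀ s, c s ∈ 𝒯.shell) (ζ : Sec 𝒯.E.dual) :
    ∀ᶠ χ in cutoffs d N, ∀ᶠ s in 𝓝 (0 : ℝ), lieDeriv X (𝒯.augmented μ B (χ • ζ)) (c s) =
      lieDeriv X B (c s) - lieDeriv (𝒯.anchorField ζ) A (c s) := by
  filter_upwards [hA.eventually_dirDeriv_localOp 𝒯.V_local hc ζ] with χ hχ
  filter_upwards [hχ] with s hs
  have hcompact := χ.isCompact_supp_smul ζ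
  rw [lieDeriv, dirDeriv_augmented hB.smoothFunctional hcompact,
    (hX.isResponse (hcs s)).pair_eq _ hcompact, hs]
  rfl

theorem IsFluctuation.eventually_dirDeriv_lieDeriv (hX : 𝒯.IsFluctuation μ σ A X)
    (hA : IsFunctional μ A) (hB : IsFunctional μ B) (hζ : 𝒯.IsMultiplier μ σ φ B ζ)
    {γ : ℝ → Sec 𝒯.B} {Y : Sec 𝒯.B} (hγ : 𝒯.IsShellCurve γ φ Y) :
    ∀ᶠ χ in cutoffs d N, dirDeriv (lieDeriv X B) φ Y =
      dirDeriv₂ (𝒯.augmented μ B (χ • ζ)) φ Y (X φ) +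
        dirDeriv (lieDeriv (𝒯.anchorField ζ) A) φ Y := by
  obtain ⟨hXs, hXS, -⟩ := hX.1
  obtain ⟨K, hK, hXK⟩ := hXS.exists_supp_dir_subset (fun K hK => Dir.isClosed hK) hXs φ Y
  filter_upwards [hζ.eventually_dirDeriv_lieDeriv hB hXs (Dir.sets_mono hK (isClosed_supp _) hXK),
    hX.eventually_lieDeriv_augmented hA hB hγ.smooth hγ.mem_shell ζ] with χ hdir hcurve
  have hXB := hB.smoothFunctional.lieDeriv hXs
  have hVA := hA.smoothFunctional.lieDeriv (smoothMap_anchorField ζ)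
  have haug := smoothFunctional_augmented (μ := μ) hB.smoothFunctional (χ.isCompact_supp_smul ζ)
  rw [← hdir, hγ.dirDeriv_congr (haug.lieDeriv hXs) (hXB.sub hVA) hcurve,
    hXB.dirDeriv_sub_functional hVA, sub_add_cancel]

end Fluctuations

end FieldTheory

/-! ### The anchor along the shell -/

namespace FieldTheory

section StructureFunctions

variable [MeasurableSpace N]

/-- A choice of local structure functions `C_{ab}^d`, `D_{ab}^α`, `W_a^{ij}` of the Lagrange anchor,
with free indices contracted with test sections. -/
structure StructureFunctions (𝒯 : FieldTheory.{u, v} d N) (μ : Measure (Spacetime N)) where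
  C : Sec 𝒯.B → Sec 𝒯.E.dual →ₗ[ℝ] Sec 𝒯.E.dual →ₗ[ℝ] Sec 𝒯.E.dual
  D : Sec 𝒯.B → Sec 𝒯.E.dual →ₗ[ℝ] Sec 𝒯.E.dual →ₗ[ℝ] Sec 𝒯.G
  W : Sec 𝒯.B → Sec 𝒯.E.dual →ₗ[ℝ] Sec 𝒯.B.dual →ₗ[ℝ] Sec 𝒯.B
  C_local : IsLocalBiop C
  W_local : IsLocalBiop W
  compat : ∀ (φ : Sec 𝒯.B) (a b : Sec 𝒯.E.dual), IsCompact (supp a) → IsCompact (supp b) →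
    pair μ b (𝒯.J φ (𝒯.V φ a)) - pair μ a (𝒯.J φ (𝒯.V φ b)) = pair μ (C φ a b) (𝒯.T φ)
  W_symm : ∀ φ ∈ 𝒯.shell, ∀ (a : Sec 𝒯.E.dual) (α β : Sec 𝒯.B.dual),
    IsCompact (supp α) → IsCompact (supp β) → pair μ β (W φ a α) = pair μ α (W φ a β)
  commutator : ∀ φ ∈ 𝒯.shell, ∀ (a b : Sec 𝒯.E.dual) (γ : Sec 𝒯.B.dual), IsCompact (supp γ) →
    pair μ γ (𝒯.anchorCommutator φ a b) =
      pair μ γ (𝒯.V φ (C φ a b)) + pair μ γ (𝒯.R φ (D φ a b))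
        + pair μ a (𝒯.J φ (W φ b γ)) - pair μ b (𝒯.J φ (W φ a γ))

theorem IsLagrangeStructure.nonempty_structureFunctions {𝒯 : FieldTheory.{u, v} d N}
    {μ : Measure (Spacetime N)} (h : 𝒯.IsLagrangeStructure μ) :
    Nonempty (𝒯.StructureFunctions μ) := by
  obtain ⟨C, D, W, hC, -, hW, hcompat, hsymm, hcomm⟩ := h
  exact ⟨C, D, W, hC, hW, hcompat, hsymm, hcomm⟩

end StructureFunctions

section AnchorTransport

variable [MeasurableSpace N] {μ : Measure (Spacetime N)} {𝒯 : FieldTheory.{u, v} d N} {σ : Dir}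
  {φ : Sec 𝒯.B} {A B C : Sec 𝒯.B → ℝ} {a b ζ ζA ζB : Sec 𝒯.E.dual} {z : Sec 𝒯.B}
  [IsManifold (𝓡 d) ∞ N] [T2Space N] [SecondCountableTopology N] (𝒮 : 𝒯.StructureFunctions μ)

include 𝒮 in
theorem IsMultiplier.pair_J_anchor (hζ : 𝒯.IsMultiplier μ σ φ A ζ) (hφ : φ ∈ 𝒯.shell)
    (hb : IsCompact (supp b)) : pair μ b (𝒯.J φ (𝒯.V φ ζ)) = dirDeriv A φ (𝒯.V φ b) := by
  obtain ⟨χ, hχ⟩ := (eventually_smul_eq_of_isCompact hb ζ).exists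
  have hVb : supp (𝒯.V φ b) ⊆ supp b := 𝒯.V_local.supp_subset φ b
  have hleft : pair μ b (𝒯.J φ (𝒯.V φ ζ)) = pair μ b (𝒯.J φ (𝒯.V φ (χ • ζ))) :=
    pair_congr μ fun x => by
      by_cases hx : x ∈ supp b
      · rw [J_V_congr φ (hχ x hx)]
      · rw [ev_eq_zero_of_notMem_supp hx, ev_eq_zero_of_notMem_supp hx]
  have hright : pair μ ζ (𝒯.J φ (𝒯.V φ b)) = pair μ (χ • ζ) (𝒯.J φ (𝒯.V φ b)) :=
    pair_congr μ fun x => by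
      by_cases hx : x ∈ supp b
      · rw [(hχ x hx).self_of_nhds]
      · rw [J_eq_zero_of_notMem_supp φ fun h => hx (hVb h), ev_zero_right, ev_zero_right]
  have hcompat := 𝒮.compat φ (χ • ζ) b (χ.isCompact_supp_smul ζ) hb
  rw [show 𝒯.T φ = 0 from hφ, ContMDiffSection.coe_zero, pair_zero_right, sub_eq_zero] at hcompat
  rw [hleft, hcompat, ← hright, hζ.dirDeriv_eq _ (hb.of_isClosed_subset (isClosed_supp _) hVb)]

variable [BorelSpace N] [IsFiniteMeasureOnCompacts μ]

include 𝒮 in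
theorem exists_isShellCurve [μ.IsOpenPosMeasure] (hregular : 𝒯.IsRegular) (hφ : φ ∈ 𝒯.shell)
    (hζ : 𝒯.IsMultiplier μ σ φ A ζ) (hz : 𝒯.IsResponse μ σ φ A z) :
    ∃ γ, 𝒯.IsShellCurve γ φ (𝒯.V φ ζ - z) := by
  have hVζ : supp (𝒯.V φ ζ) ∈ spatiallyCompactSets N :=
    spatiallyCompactSets.mono (Dir.mem_spatiallyCompactSets hζ.supp_mem) (isClosed_supp _)
      (𝒯.V_local.supp_subset φ ζ)
  obtain ⟨γ, hγ, hγs, hγ0, hγv⟩ := hregular φ hφ _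
    (spatiallyCompactSets.mono
      (spatiallyCompactSets.union hVζ (Dir.mem_spatiallyCompactSets hz.supp_mem))
      (isClosed_supp _) (supp_sub_subset _ _))
    (J_sub_eq_zero (μ := μ) fun b hb => by rw [hζ.pair_J_anchor 𝒮 hφ hb, hz.pair_eq b hb])
  exact ⟨γ, hγ, hγs, hγ0, hγv⟩

theorem dirDeriv_lieDeriv_anchorField_congr (hb : IsCompact (supp b)) {η η' : Sec 𝒯.E.dual}
    (h : ∀ x ∈ supp z, ∀ᶠ y in 𝓝 x, η y = η' y) :
    dirDeriv (lieDeriv (𝒯.anchorField η) (𝒯.test μ b)) φ z =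
      dirDeriv (lieDeriv (𝒯.anchorField η') (𝒯.test μ b)) φ z := by
  have htest := smoothFunctional_test (μ := μ) hb
  have hdir : (smoothMap_anchorField η).dir φ z = (smoothMap_anchorField η').dir φ z := by
    ext x
    by_cases hx : x ∈ supp z
    · simp only [SmoothMap.dir_apply, anchorField, 𝒯.V_local.congr_right _ (h x hx)]
    · exact (eq_zero_of_notMem_supp fun h => hx (𝒯.V_local.supp_dir_subset_dir η φ z h)).trans
        (eq_zero_of_notMem_supp fun h => hx (𝒯.V_local.supp_dir_subset_dir η' φ z h)).symm
  have hline (s : ℝ) : pair μ b (𝒯.J (φ + s • 𝒯.V φ η) z) =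
      pair μ b (𝒯.J (φ + s • 𝒯.V φ η') z) := pair_congr μ fun x => by
    by_cases hx : x ∈ supp z
    · rw [J_congr (eventually_line_eq φ _ s)]
      filter_upwards [eventually_eventually_nhds.2 (h x hx)] with y hy
        using 𝒯.V_local.congr_right φ hy
    · rw [J_eq_zero_of_notMem_supp _ hx, J_eq_zero_of_notMem_supp _ hx]
  rw [htest.dirDeriv_lieDeriv (smoothMap_anchorField η),
    htest.dirDeriv_lieDeriv (smoothMap_anchorField η'), hdir, htest.dirDeriv₂_comm,
    htest.dirDeriv₂_comm φ z]
  simp only [dirDeriv₂, dirDeriv_test hb]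
  simp only [dirDeriv, anchorField, hline]

theorem dirDeriv_pair_T {Z : Sec 𝒯.B → Sec 𝒯.E.dual} (hZ : SmoothMap Z)
    {K : Set (Spacetime N)} (hK : IsCompact K) (hZK : ∀ ψ, supp (Z ψ) ⊆ K) (hφ : φ ∈ 𝒯.shell)
    (z : Sec 𝒯.B) :
    dirDeriv (fun ψ => pair μ (Z ψ) (𝒯.T ψ)) φ z = pair μ (Z φ) (𝒯.J φ z) := by
  have hsmooth : ContDiff ℝ ∞
      (fun q : ℝ × ℝ => pair μ (Z (φ + q.1 • z)) (𝒯.T (φ + q.2 • z))) :=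
    contDiff_pair μ ((hZ.line φ z).comp contDiff_fst) ((𝒯.T_local.2.line φ z).comp contDiff_snd)
      hK fun q => hZK _
  have hT : 𝒯.T φ = 0 := hφ
  have hZφ : IsCompact (supp (Z φ)) := hK.of_isClosed_subset (isClosed_supp _) (hZK φ)
  refine (hasDerivAt_diag (a := 0) (hsmooth.differentiable (by simp) 0) ?_ ?_).deriv.trans
    (zero_add _)
  · simpa [hT, pair_zero_right] using hasDerivAt_const (0 : ℝ) (0 : ℝ)
  · simpa [test, ← dirDeriv_test hZφ] using
      (smoothFunctional_test (μ := μ) hZφ).hasDerivAt_line φ z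

theorem StructureFunctions.dirDeriv_test_sub (ha : IsCompact (supp a)) (hb : IsCompact (supp b))
    (hφ : φ ∈ 𝒯.shell) (z : Sec 𝒯.B) :
    dirDeriv (lieDeriv (𝒯.anchorField a) (𝒯.test μ b)) φ z -
      dirDeriv (lieDeriv (𝒯.anchorField b) (𝒯.test μ a)) φ z =
        pair μ (𝒮.C φ a b) (𝒯.J φ z) := by
  have hC : SmoothMap (fun ψ => 𝒮.C ψ a b) := fun P _ _ _ ψ hψ =>
    𝒮.C_local.2 P ψ _ _ hψ (.const a) (.const b)
  have hLa := (smoothFunctional_test (μ := μ) hb).lieDeriv (smoothMap_anchorField a)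
  have hLb := (smoothFunctional_test (μ := μ) ha).lieDeriv (smoothMap_anchorField b)
  rw [← hLa.dirDeriv_sub_functional hLb,
    ← dirDeriv_pair_T hC ha (fun ψ => 𝒮.C_local.supp_subset_left ψ a b) hφ]
  simp only [lieDeriv, dirDeriv_test ha, dirDeriv_test hb, anchorField, 𝒮.compat _ a b ha hb]

theorem StructureFunctions.eventually_dirDeriv_test_sub (hφ : φ ∈ 𝒯.shell)
    (hC : IsFunctional μ C) (hA : 𝒯.IsMultiplier μ σ φ A ζA) (hB : 𝒯.IsMultiplier μ σ φ B ζB)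
    (hz : 𝒯.IsResponse μ σ φ C z) :
    ∀ᶠ χ in cutoffs d N,
      dirDeriv (lieDeriv (𝒯.anchorField ζB) (𝒯.test μ (χ • ζA))) φ z -
        dirDeriv (lieDeriv (𝒯.anchorField ζA) (𝒯.test μ (χ • ζB))) φ z =
          dirDeriv C φ (𝒯.V φ (𝒮.C φ ζB ζA)) := by
  obtain ⟨K, hK, hCK⟩ := hC.exists_isCompact_dirDeriv_congr_at φ
  filter_upwards [eventually_smul_eq_of_isCompact hK ζA, eventually_smul_eq_of_isCompact hK ζB,
    eventually_smul_eq (Dir.isCompact_inter hz.supp_mem hA.supp_mem),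
    eventually_smul_eq (Dir.isCompact_inter hz.supp_mem hB.supp_mem)] with χ hKA hKB hzA hzB
  have hcA := χ.isCompact_supp_smul ζA
  have hcB := χ.isCompact_supp_smul ζB
  rw [← dirDeriv_lieDeriv_anchorField_congr hcA hzB, ← dirDeriv_lieDeriv_anchorField_congr hcB hzA,
    𝒮.dirDeriv_test_sub hcB hcA hφ, hz.pair_eq _
      (hcB.of_isClosed_subset (isClosed_supp _) (𝒮.C_local.supp_subset_left φ _ _))]
  refine hCK _ _ fun x hx => 𝒯.V_local.congr_right φ ?_
  filter_upwards [eventually_eventually_nhds.2 (hKB x hx), eventually_eventually_nhds.2 (hKA x hx)]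
    with y hyB hyA using 𝒮.C_local.congr φ hyB hyA

theorem IsMultiplier.eventually_dirDeriv_anchor (hζ : 𝒯.IsMultiplier μ σ φ A ζ)
    (hA : IsFunctional μ A) (hz : supp z ∈ σ.sets N) (η : Sec 𝒯.E.dual) :
    ∀ᶠ χ in cutoffs d N, dirDeriv (lieDeriv (𝒯.anchorField η) A) φ z =
      dirDeriv₂ (𝒯.augmented μ A (χ • ζ)) φ z (𝒯.V φ η) +
        dirDeriv (lieDeriv (𝒯.anchorField η) (𝒯.test μ (χ • ζ))) φ z := by
  have hη := smoothMap_anchorField (𝒯 := 𝒯) η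
  filter_upwards [hζ.eventually_dirDeriv_lieDeriv hA hη (Dir.sets_mono hz (isClosed_supp _)
    (𝒯.V_local.supp_dir_subset_dir η φ z))] with χ hχ
  have htest := smoothFunctional_test (μ := μ) (χ.isCompact_supp_smul ζ)
  have hsub : lieDeriv (𝒯.anchorField η) (𝒯.augmented μ A (χ • ζ)) =
      fun ψ => lieDeriv (𝒯.anchorField η) A ψ -
        lieDeriv (𝒯.anchorField η) (𝒯.test μ (χ • ζ)) ψ :=
    funext fun ψ => hA.smoothFunctional.dirDeriv_sub_functional htest ψ _
  rw [hsub, (hA.smoothFunctional.lieDeriv hη).dirDeriv_sub_functional (htest.lieDeriv hη)] at hχ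
  exact sub_eq_iff_eq_add.1 hχ

theorem StructureFunctions.eventually_dirDeriv_anchor_sub (hφ : φ ∈ 𝒯.shell)
    (hA : IsFunctional μ A) (hB : IsFunctional μ B) (hC : IsFunctional μ C)
    (hζA : 𝒯.IsMultiplier μ σ φ A ζA) (hζB : 𝒯.IsMultiplier μ σ φ B ζB)
    (hz : 𝒯.IsResponse μ σ φ C z) :
    ∀ᶠ χ in cutoffs d N,
      dirDeriv (lieDeriv (𝒯.anchorField ζB) A) φ z -
        dirDeriv (lieDeriv (𝒯.anchorField ζA) B) φ z =
          dirDeriv₂ (𝒯.augmented μ A (χ • ζA)) φ z (𝒯.V φ ζB) -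
            dirDeriv₂ (𝒯.augmented μ B (χ • ζB)) φ z (𝒯.V φ ζA) +
              dirDeriv C φ (𝒯.V φ (𝒮.C φ ζB ζA)) := by
  filter_upwards [hζA.eventually_dirDeriv_anchor hA hz.supp_mem ζB,
    hζB.eventually_dirDeriv_anchor hB hz.supp_mem ζA,
    𝒮.eventually_dirDeriv_test_sub hφ hC hζA hζB hz] with χ hχA hχB htest
  rw [hχA, hχB, ← htest]
  ring

end AnchorTransport

end FieldTheory

/-! ### The Jacobi identity -/

section CrossDerivative

variable {B : VBundle.{u, v} d N} {F : Sec B → ℝ}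

/-- For the second derivative `F''` at `φ`, the expression `F''(a, b) - F''(a - z, b - w)`, bilinear
in the pairs `(a, z)` and `(b, w)`. -/
def crossDeriv (F : Sec B → ℝ) (φ a z b w : Sec B) : ℝ :=
  dirDeriv₂ F φ a b - dirDeriv₂ F φ (a - z) (b - w)

variable [IsManifold (𝓡 d) ∞ N]

theorem SmoothFunctional.crossDeriv_comm (hF : SmoothFunctional F) (φ a z b w : Sec B) :
    crossDeriv F φ a z b w = crossDeriv F φ b w a z := by
  rw [crossDeriv, crossDeriv, hF.dirDeriv₂_comm φ a b, hF.dirDeriv₂_comm φ (a - z)]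

theorem SmoothFunctional.crossDeriv_eq (hF : SmoothFunctional F) (φ a z b w : Sec B) :
    crossDeriv F φ a z b w = dirDeriv₂ F φ (a - z) w + dirDeriv₂ F φ z b := by
  rw [crossDeriv, hF.dirDeriv₂_sub_right, hF.dirDeriv₂_sub_left φ a z b]
  ring

end CrossDerivative

namespace FieldTheory

section JacobiIdentity

variable [MeasurableSpace N] {μ : Measure (Spacetime N)} {𝒯 : FieldTheory.{u, v} d N} {σ : Dir}
  {φ : Sec 𝒯.B} {A B C AB : Sec 𝒯.B → ℝ} {ζA ζB ζC : Sec 𝒯.E.dual} {zA zB zC : Sec 𝒯.B}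

variable (μ 𝒯) in
/-- An observable `A` with a Lagrange multiplier `ζ` and a response `z` at the field `φ`. -/
structure IsFirstOrderData (σ : Dir) (φ : Sec 𝒯.B) (A : Sec 𝒯.B → ℝ) (ζ : Sec 𝒯.E.dual)
    (z : Sec 𝒯.B) : Prop where
  observable : 𝒯.IsObservable μ A
  multiplier : 𝒯.IsMultiplier μ σ φ A ζ
  response : 𝒯.IsResponse μ σ φ A z

theorem IsObservable.exists_isFirstOrderData [T2Space N] (hA : 𝒯.IsObservable μ A)
    (hdual : 𝒯.IsDualExact μ σ.op) {X : Sec 𝒯.B → Sec 𝒯.B} (hX : 𝒯.IsFluctuation μ σ A X)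
    (hφ : φ ∈ 𝒯.shell) : ∃ ζ, 𝒯.IsFirstOrderData μ σ φ A ζ (X φ) :=
  (hA.exists_isMultiplier hdual hφ).imp fun _ hζ => ⟨hA, hζ, hX.isResponse hφ⟩

namespace StructureFunctions

/-- The part of the iterated bracket `{{A, B}, C}` at `φ` that involves the observables only through
the anchor, `ζA`, `ζB` and `ζC` being Lagrange multipliers of `A`, `B` and `C`. -/
def anchorTerm (𝒮 : 𝒯.StructureFunctions μ) (φ : Sec 𝒯.B) (A B C : Sec 𝒯.B → ℝ)
    (ζA ζB ζC : Sec 𝒯.E.dual) : ℝ :=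
  dirDeriv (lieDeriv (𝒯.anchorField ζB) A) φ (𝒯.V φ ζC) -
    dirDeriv (lieDeriv (𝒯.anchorField ζA) B) φ (𝒯.V φ ζC) -
      dirDeriv C φ (𝒯.V φ (𝒮.C φ ζB ζA))

variable (𝒮 : 𝒯.StructureFunctions μ) [IsManifold (𝓡 d) ∞ N] [T2Space N]
  [SecondCountableTopology N]

theorem dirDeriv_anchor_sub_of_isGradient (hφ : φ ∈ 𝒯.shell) (hA : 𝒯.IsObservable μ A)
    (hζB : 𝒯.IsMultiplier μ σ φ B ζB) (hζC : 𝒯.IsMultiplier μ σ φ C ζC) {α : Sec 𝒯.B.dual}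
    (hα : IsGradient μ A φ α) :
    dirDeriv (lieDeriv (𝒯.anchorField ζB) A) φ (𝒯.V φ ζC) -
      dirDeriv (lieDeriv (𝒯.anchorField ζC) A) φ (𝒯.V φ ζB) -
        dirDeriv A φ (𝒯.V φ (𝒮.C φ ζC ζB)) =
          dirDeriv C φ (𝒮.W φ ζB α) - dirDeriv B φ (𝒮.W φ ζC α) := by
  have hF := hA.1.smoothFunctional
  have hW (a : Sec 𝒯.E.dual) : IsCompact (supp (𝒮.W φ a α)) :=
    hα.isCompact_supp.of_isClosed_subset (isClosed_supp _) (𝒮.W_local.supp_subset_right φ a α)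
  have hcommutator := 𝒮.commutator φ hφ ζC ζB α hα.isCompact_supp
  have hdir : 𝒯.anchorCommutator φ ζC ζB =
      (((smoothMap_anchorField ζB).dir φ (𝒯.V φ ζC) -
        (smoothMap_anchorField ζC).dir φ (𝒯.V φ ζB) : Sec 𝒯.B) : ∀ x, 𝒯.B.fib x) := rfl
  rw [hdir, ← hα.dirDeriv_eq, ← hα.dirDeriv_eq, ← hα.dirDeriv_eq, hA.dirDeriv_gauge hφ,
    hF.dirDeriv_sub, ← hζC.dirDeriv_eq _ (hW ζB), ← hζB.dirDeriv_eq _ (hW ζC)] at hcommutator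
  have hsymm : dirDeriv₂ A φ (𝒯.V φ ζC) (𝒯.V φ ζB) = dirDeriv₂ A φ (𝒯.V φ ζB) (𝒯.V φ ζC) :=
    hF.dirDeriv₂_comm φ _ _
  rw [hF.dirDeriv_lieDeriv (smoothMap_anchorField ζB),
    hF.dirDeriv_lieDeriv (smoothMap_anchorField ζC), anchorField, anchorField, hsymm]
  linarith

theorem anchorTerm_cyclic_sum (hφ : φ ∈ 𝒯.shell) (hA : 𝒯.IsObservable μ A)
    (hB : 𝒯.IsObservable μ B) (hC : 𝒯.IsObservable μ C) (hζA : 𝒯.IsMultiplier μ σ φ A ζA)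
    (hζB : 𝒯.IsMultiplier μ σ φ B ζB) (hζC : 𝒯.IsMultiplier μ σ φ C ζC) :
    𝒮.anchorTerm φ A B C ζA ζB ζC + 𝒮.anchorTerm φ B C A ζB ζC ζA +
      𝒮.anchorTerm φ C A B ζC ζA ζB = 0 := by
  obtain ⟨α, hα⟩ := hA.1.exists_isGradient φ
  obtain ⟨β, hβ⟩ := hB.1.exists_isGradient φ
  obtain ⟨κ, hκ⟩ := hC.1.exists_isGradient φ
  have hWA := 𝒮.W_symm φ hφ ζA β κ hβ.isCompact_supp hκ.isCompact_supp
  have hWB := 𝒮.W_symm φ hφ ζB κ α hκ.isCompact_supp hα.isCompact_supp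
  have hWC := 𝒮.W_symm φ hφ ζC α β hα.isCompact_supp hβ.isCompact_supp
  have hAdef := 𝒮.dirDeriv_anchor_sub_of_isGradient hφ hA hζB hζC hα
  have hBdef := 𝒮.dirDeriv_anchor_sub_of_isGradient hφ hB hζC hζA hβ
  have hCdef := 𝒮.dirDeriv_anchor_sub_of_isGradient hφ hC hζA hζB hκ
  rw [hκ.dirDeriv_eq (𝒮.W φ ζB α), hβ.dirDeriv_eq (𝒮.W φ ζC α)] at hAdef
  rw [hα.dirDeriv_eq (𝒮.W φ ζC β), hκ.dirDeriv_eq (𝒮.W φ ζA β)] at hBdef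
  rw [hβ.dirDeriv_eq (𝒮.W φ ζA κ), hα.dirDeriv_eq (𝒮.W φ ζB κ)] at hCdef
  simp only [anchorTerm]
  linarith

variable [BorelSpace N] [IsFiniteMeasureOnCompacts μ] [μ.IsOpenPosMeasure]

theorem eventually_iterated_bracket (hregular : 𝒯.IsRegular) (hgauge : 𝒯.IsGaugeSymmetry)
    (hexact : 𝒯.IsExact σ) (hφ : φ ∈ 𝒯.shell) (hA : 𝒯.IsFirstOrderData μ σ φ A ζA zA)
    (hB : 𝒯.IsFirstOrderData μ σ φ B ζB zB) (hC : 𝒯.IsFirstOrderData μ σ φ C ζC zC)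
    (hAB : 𝒯.IsBracket μ σ A B AB) {U : Sec 𝒯.B → Sec 𝒯.B} (hU : 𝒯.IsFluctuation μ σ AB U) :
    ∀ᶠ χ in cutoffs d N, dirDeriv C φ (U φ) - dirDeriv AB φ zC =
      crossDeriv (𝒯.augmented μ B (χ • ζB)) φ (𝒯.V φ ζC) zC (𝒯.V φ ζA) zA -
        crossDeriv (𝒯.augmented μ A (χ • ζA)) φ (𝒯.V φ ζC) zC (𝒯.V φ ζB) zB +
          𝒮.anchorTerm φ A B C ζA ζB ζC := by
  obtain ⟨X, Y, hX, hY, hXY⟩ := hAB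
  obtain rfl : AB = fun ψ => lieDeriv X B ψ - lieDeriv Y A ψ := funext hXY
  have hFA := hA.observable.1
  have hFB := hB.observable.1
  have hbracket : IsFunctional μ (fun ψ => lieDeriv X B ψ - lieDeriv Y A ψ) :=
    (hX.1.2.2 B hFB).sub (hY.1.2.2 A hFA)
  have hVA := hFA.smoothFunctional.lieDeriv (smoothMap_anchorField ζB)
  have hVB := hFB.smoothFunctional.lieDeriv (smoothMap_anchorField ζA)
  obtain ⟨γ, hγ⟩ := exists_isShellCurve 𝒮 hregular hφ hC.multiplier hC.response
  filter_upwards [hX.eventually_dirDeriv_lieDeriv hFA hFB hB.multiplier hγ,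
    hY.eventually_dirDeriv_lieDeriv hFB hFA hA.multiplier hγ,
    eventually_dirDeriv₂_augmented_response hgauge hexact hφ hB.observable hB.multiplier hγ
      (hX.isResponse hφ) hA.response,
    eventually_dirDeriv₂_augmented_response hgauge hexact hφ hA.observable hA.multiplier hγ
      (hY.isResponse hφ) hB.response,
    𝒮.eventually_dirDeriv_anchor_sub hφ hFA hFB hC.observable.1 hA.multiplier hB.multiplier
      hC.response] with χ hXB hYA hXz hYz hanchor
  rw [hC.multiplier.dirDeriv_response hC.observable.1 hbracket (hU.isResponse hφ),
    ← hbracket.smoothFunctional.dirDeriv_sub,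
    (hFB.smoothFunctional.lieDeriv hX.1.1).dirDeriv_sub_functional
      (hFA.smoothFunctional.lieDeriv hY.1.1), hXB, hYA, hXz, hYz, hVA.dirDeriv_sub,
    hVB.dirDeriv_sub, (smoothFunctional_augmented hFA.smoothFunctional
      (χ.isCompact_supp_smul ζA)).crossDeriv_eq, (smoothFunctional_augmented hFB.smoothFunctional
      (χ.isCompact_supp_smul ζB)).crossDeriv_eq, anchorTerm]
  linarith

end StructureFunctions

theorem IsFirstOrderData.crossDeriv_comm [IsManifold (𝓡 d) ∞ N] [T2Space N]
    [SecondCountableTopology N] [BorelSpace N] [IsFiniteMeasureOnCompacts μ]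
    (hA : 𝒯.IsFirstOrderData μ σ φ A ζA zA) (χ : Cutoff d N) (a z b w : Sec 𝒯.B) :
    crossDeriv (𝒯.augmented μ A (χ • ζA)) φ a z b w =
      crossDeriv (𝒯.augmented μ A (χ • ζA)) φ b w a z :=
  (smoothFunctional_augmented hA.observable.1.smoothFunctional
    (χ.isCompact_supp_smul ζA)).crossDeriv_comm φ a z b w

end JacobiIdentity

end FieldTheory

end CovariantBracket

end

theorem proposition4p3_general {d : ℕ} {N : Type*} [TopologicalSpace N] [T2Space N]
    [SecondCountableTopology N] [ChartedSpace (EuclideanSpace ℝ (Fin d)) N]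
    [IsManifold (𝓡 d) ∞ N] [MeasurableSpace N] [BorelSpace N]
    (μ : Measure (ℝ × N)) [IsFiniteMeasureOnCompacts μ] [μ.IsOpenPosMeasure]
    (𝒯 : CovariantBracket.FieldTheory d N)
    (hregular : 𝒯.IsRegular)
    (hgauge : 𝒯.IsGaugeSymmetry)
    (σ : CovariantBracket.Dir)
    (hexact : 𝒯.IsExact σ)
    (hdual : 𝒯.IsDualExact μ σ.op)
    (hanchor : 𝒯.IsLagrangeStructure μ)
    (A B C : CovariantBracket.Sec 𝒯.B → ℝ)
    (hA : 𝒯.IsObservable μ A) (hB : 𝒯.IsObservable μ B) (hC : 𝒯.IsObservable μ C)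
    (AB BC CA AB_C BC_A CA_B : CovariantBracket.Sec 𝒯.B → ℝ)
    (hAB : 𝒯.IsBracket μ σ A B AB) (hBC : 𝒯.IsBracket μ σ B C BC)
    (hCA : 𝒯.IsBracket μ σ C A CA)
    (hAB_C : 𝒯.IsBracket μ σ AB C AB_C) (hBC_A : 𝒯.IsBracket μ σ BC A BC_A)
    (hCA_B : 𝒯.IsBracket μ σ CA B CA_B) :
    ∀ φ ∈ 𝒯.shell, AB_C φ + BC_A φ + CA_B φ = 0 := by
  intro φ hφ
  obtain ⟨𝒮⟩ := hanchor.nonempty_structureFunctions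
  obtain ⟨UAB, ZC, hUAB, hZC, hABC⟩ := hAB_C
  obtain ⟨UBC, ZA, hUBC, hZA, hBCA⟩ := hBC_A
  obtain ⟨UCA, ZB, hUCA, hZB, hCAB⟩ := hCA_B
  obtain ⟨ζA, hdA⟩ := hA.exists_isFirstOrderData hdual hZA hφ
  obtain ⟨ζB, hdB⟩ := hB.exists_isFirstOrderData hdual hZB hφ
  obtain ⟨ζC, hdC⟩ := hC.exists_isFirstOrderData hdual hZC hφ
  obtain ⟨χ, ⟨hχC, hχA⟩, hχB⟩ :=
    (((𝒮.eventually_iterated_bracket hregular hgauge hexact hφ hdA hdB hdC hAB hUAB).and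
      (𝒮.eventually_iterated_bracket hregular hgauge hexact hφ hdB hdC hdA hBC hUBC)).and
      (𝒮.eventually_iterated_bracket hregular hgauge hexact hφ hdC hdA hdB hCA hUCA)).exists
  have hanchorTerm :=
    𝒮.anchorTerm_cyclic_sum hφ hA hB hC hdA.multiplier hdB.multiplier hdC.multiplier
  rw [hABC, hBCA, hCAB, hχC, hχA, hχB, hdA.crossDeriv_comm χ (𝒯.V φ ζC),
    hdB.crossDeriv_comm χ (𝒯.V φ ζA), hdC.crossDeriv_comm χ (𝒯.V φ ζB)]
  linarith

theorem proposition4p3 {d : ℕ} {N : Type*} [TopologicalSpace N] [T2Space N]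
    [SecondCountableTopology N] [ChartedSpace (EuclideanSpace ℝ (Fin d)) N]
    [IsManifold (𝓡 d) ∞ N] [MeasurableSpace N] [BorelSpace N]
    (μ : Measure (ℝ × N)) [IsFiniteMeasureOnCompacts μ] [μ.IsOpenPosMeasure]
    (𝒯 : CovariantBracket.FieldTheory d N)
    (hregular : 𝒯.IsRegular)
    (hgauge : 𝒯.IsGaugeSymmetry)
    (hexact : ∀ σ, 𝒯.IsExact σ)
    (hdual : ∀ σ, 𝒯.IsDualExact μ σ)
    (hanchor : 𝒯.IsLagrangeStructure μ)
    (σ : CovariantBracket.Dir)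
    (A B C : CovariantBracket.Sec 𝒯.B → ℝ)
    (hA : 𝒯.IsObservable μ A) (hB : 𝒯.IsObservable μ B) (hC : 𝒯.IsObservable μ C)
    (AB BC CA AB_C BC_A CA_B : CovariantBracket.Sec 𝒯.B → ℝ)
    (hAB : 𝒯.IsBracket μ σ A B AB) (hBC : 𝒯.IsBracket μ σ B C BC)
    (hCA : 𝒯.IsBracket μ σ C A CA)
    (hAB_C : 𝒯.IsBracket μ σ AB C AB_C) (hBC_A : 𝒯.IsBracket μ σ BC A BC_A)
    (hCA_B : 𝒯.IsBracket μ σ CA B CA_B) :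
    ∀ φ ∈ 𝒯.shell, AB_C φ + BC_A φ + CA_B φ = 0 :=
  proposition4p3_general μ 𝒯 hregular hgauge σ (hexact σ) (hdual σ.op) hanchor A B C hA hB hC
    AB BC CA AB_C BC_A CA_B hAB hBC hCA hAB_C hBC_A hCA_B
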